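/- Let $d\ge 4$, $k\in\{2,3,\dots,d-2\}$, $m:=\min\{d-k,k\}$ and $1\le p,q\le\infty$ (with $\frac1\infty:=0$). Let $G_k:=O(d-k)\times O(k)$ act on $\mathbb{R}^d=\mathbb{R}^{d-k}\times\mathbb{R}^k$, and call $f:\mathbb{R}^d\to\mathbb{C}$ $G_k$-symmetric if $f\circ A=f$ for every $A\in G_k$. Let $\sigma$ be the surface measure on the unit sphere $\mathbb{S}^{d-1}\subset\mathbb{R}^d$ and $\widehat f(\xi)=\int_{\mathbb{R}^d}f(x)e^{-i\xi\cdot x}\,dx$. Suppose that there is a constant $C<\infty$ such that $$\|\widehat f\|_{L^q(\mathbb{S}^{d-1},\sigma)}\le C\,\|f\|_{L^p(\mathbb{R}^d)}$$ for every $G_k$-symmetric Schwartz function $f:\mathbb{R}^d\to\mathbb{C}$. Then one of the following conditions is satisfied: (i) $\frac{d+1}{2d}<\frac1p<\frac{m+1}{2m}$ and $\frac{d+m}{p}+\frac{d-m}{q}\ge d+1$; (ii) $\frac1p=\frac{m+1}{2m}$ and $\frac1p+\frac1q>1$; (iii) $\frac1p>\frac{m+1}{2m}$ and $\frac1p+\frac1q\ge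 1$. -/

import Mathlib

open MeasureTheory
open scoped ENNReal NNReal SchwartzMap

noncomputable section

/-- The group `G_k = O(d-k) × O(k)`, as the subgroup of `O(d)` of the orthogonal matrices that are
block diagonal for the splitting `ℝ^d = ℝ^{d-k} × ℝ^k` (the first `d-k` coordinates, and the
remaining `k` coordinates, for `k ≤ d`). -/
def blockOrthogonalGroup (d k : ℕ) : Subgroup (Matrix.orthogonalGroup (Fin d) ℝ) where
  carrier := {A | ∀ i j : Fin d, ¬ ((i : ℕ) < d - k ↔ (j : ℕ) < d - k) →
    (A : Matrix (Fin d) (Fin d) ℝ) i j = 0}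
  mul_mem' := by
    intro A B hA hB i j hij
    change ((A : Matrix (Fin d) (Fin d) ℝ) * (B : Matrix (Fin d) (Fin d) ℝ)) i j = 0
    rw [Matrix.mul_apply]
    refine Finset.sum_eq_zero fun l _ => ?_
    by_cases h : ((i : ℕ) < d - k ↔ (l : ℕ) < d - k)
    · rw [hB l j (fun h' => hij (h.trans h')), mul_zero]
    · rw [hA i l h, zero_mul]
  one_mem' := by
    intro i j hij
    change (1 : Matrix (Fin d) (Fin d) ℝ) i j = 0
    refine Matrix.one_apply_ne ?_
    rintro rfl
    exact hij Iff.rfl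
  inv_mem' := by
    intro A hA i j hij
    change (star (A : Matrix (Fin d) (Fin d) ℝ)) i j = 0
    rw [Matrix.star_apply, hA j i (fun h => hij h.symm), star_zero]

/-- For a group `G` of orthogonal `d × d` matrices, `f : ℝ^d → ℂ` is `G`-symmetric if `f ∘ A = f`
for every `A ∈ G`. -/
def IsGroupSymmetric {d : ℕ} (G : Subgroup (Matrix.orthogonalGroup (Fin d) ℝ))
    (f : EuclideanSpace ℝ (Fin d) → ℂ) : Prop :=
  ∀ A ∈ G, ∀ x : EuclideanSpace ℝ (Fin d),
    f (WithLp.toLp 2 (Matrix.mulVec (A : Matrix (Fin d) (Fin d) ℝ) (WithLp.ofLp x))) = f x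

/-- The Fourier transform `f̂(ξ) = ∫ f(x) e^{-i ξ·x} dx` on `ℝ^d`. -/
def fourierHat {d : ℕ} (f : EuclideanSpace ℝ (Fin d) → ℂ) (ξ : EuclideanSpace ℝ (Fin d)) : ℂ :=
  ∫ x, f x * Complex.exp (-(Complex.I * ((inner ℝ ξ x : ℝ) : ℂ)))

/-- The usual surface measure `σ` on the unit sphere `S^{d-1}` of `ℝ^d`. -/
def surfaceMeasure (d : ℕ) : Measure (Metric.sphere (0 : EuclideanSpace ℝ (Fin d)) 1) :=
  (volume : Measure (EuclideanSpace ℝ (Fin d))).toSphere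

/-- The restriction estimate `‖f̂‖_{L^q(S^{d-1})} ≤ C ‖f‖_{L^p(ℝ^d)}` holds within the class of
`G_k`-symmetric functions, with a constant `C` that does not depend on `f`. As usual this is an
a priori estimate for the Schwartz functions of the class, where the restriction of `f̂` to the
sphere makes sense pointwise. -/
def SymmetricRestrictionEstimate (d k : ℕ) (p q : ℝ≥0∞) : Prop :=
  ∃ C : ℝ≥0, ∀ f : 𝓢(EuclideanSpace ℝ (Fin d), ℂ),
    IsGroupSymmetric (blockOrthogonalGroup d k) f →
      eLpNorm (fun ω : Metric.sphere (0 : EuclideanSpace ℝ (Fin d)) 1 =>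
          fourierHat f (ω : EuclideanSpace ℝ (Fin d))) q (surfaceMeasure d)
        ≤ (C : ℝ≥0∞) * eLpNorm f p volume

end

/-! Write a = 1/p and b = 1/q. Every condition comes from testing the estimate on Knapp-type
examples: inverse Fourier transforms of invariant bumps concentrated near the sphere. As `𝓕` has the
kernel exp(-2πi⟨x, ξ⟩), the unit sphere appears as the sphere of radius 1/(2π).

The building block is a radial bump on ℝ^n living on a shell of thickness about 1/R. Its inverse
transform f has L² norm O(R^(-1/2)), and Plancherel applied to the gradient of the bump shows that
‖x‖ f has L² norm O(R^(1/2)). So f is essentially confined to ‖x‖ ≲ R, and Hölder with the weight (1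
+ ‖x‖/R)² gives the L^p norm O(R^(n(a - 1/2) - 1/2)) if a > 1/2 and n(2a - 1) < 2. The exponent is
negative below a = (n+1)/(2n). At this critical value, a sum of J dyadic shell bumps has height J on
the sphere, but by almost orthogonality the L^p norm of its inverse transform is only O(J^a), and a
< 1 for n ≥ 2.

For n = d these radial functions exclude a ≤ (d+1)/(2d); for a ≤ 1/2 the L^p norm is interpolated
between L² and L^∞. The other conditions use tensor products of a radial u on the block ℝ^m with a
bump on a ball of radius about δ in the remaining d - m coordinates. By curvature, a point of the
sphere at distance δ from the block deviates only by δ² from the unit sphere of the block. The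
estimate then becomes A δ^((d-m)(a+b-1)) ≲ ‖𝓕⁻u‖_p, where A bounds |u| from below on a shell of
thickness δ² (`SymmetricRestrictionEstimate.exists_le_tensor`). A fixed u and δ → 0 force a + b ≥ 1;
a shell bump with R = δ^(-2) gives the inequality in (i); at a = (m+1)/(2m) the dyadic sum with δ =
2^(-J) excludes a + b = 1. -/

noncomputable section RadialBumps

/-! ### Radial bumps on thin shells and their inverse Fourier transforms -/

open scoped FourierTransform ContDiff LineDeriv

/-- A smooth even bump on the line: `1` on `[-1, 1]`, supported in `[-2, 2]`. -/
def unitBump : ContDiffBump (0 : ℝ) := ⟨1, 2, one_pos, one_lt_two⟩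

theorem unitBump_eq_one {t : ℝ} (ht : |t| ≤ 1) : unitBump t = 1 :=
  unitBump.one_of_mem_closedBall (by simpa [unitBump] using ht)

theorem unitBump_eq_zero {t : ℝ} (ht : 2 ≤ |t|) : unitBump t = 0 :=
  unitBump.zero_of_le_dist (by simpa [unitBump] using ht)

theorem exists_abs_deriv_unitBump_le : ∃ L : ℝ, 0 < L ∧ ∀ t, |deriv unitBump t| ≤ L := by
  have h1 : Continuous (deriv unitBump) :=
    (unitBump.contDiff (n := 1)).continuous_deriv le_rfl
  obtain ⟨L, hL⟩ := unitBump.hasCompactSupport.deriv.exists_bound_of_continuous h1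
  exact ⟨max L 1, by positivity, fun t => (hL t).trans (le_max_left _ _)⟩

variable (E : Type*) [NormedAddCommGroup E] [InnerProductSpace ℝ E]

theorem hasCompactSupport_shell [FiniteDimensional ℝ E] {R : ℝ} (hR : 0 < R) :
    HasCompactSupport fun ζ : E => ((unitBump (R * (4 * Real.pi ^ 2 * ‖ζ‖ ^ 2 - 1)) : ℝ) : ℂ) := by
  refine HasCompactSupport.of_support_subset_isCompact
    (isCompact_closedBall (0 : E) (1 + 2 / R)) ?_
  intro ζ hζ
  by_contra hn
  apply hζ
  have hn' : 1 + 2 / R < ‖ζ‖ := by simpa using hn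
  have h0 : 0 < 2 / R := by positivity
  have hpi := Real.pi_gt_three
  have h1 : 1 + 2 / R < 4 * Real.pi ^ 2 * ‖ζ‖ ^ 2 := by
    have h3 : 1 ≤ 4 * Real.pi ^ 2 := by nlinarith
    have h4 : ‖ζ‖ ≤ ‖ζ‖ ^ 2 := by nlinarith
    nlinarith
  have h2 : 2 ≤ R * (4 * Real.pi ^ 2 * ‖ζ‖ ^ 2 - 1) := by
    calc (2 : ℝ) = R * (2 / R) := by field_simp
      _ ≤ _ := by gcongr; linarith
  simp only [Complex.ofReal_eq_zero]
  exact unitBump_eq_zero (h2.trans (le_abs_self _))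

theorem contDiff_shell (R : ℝ) :
    ContDiff ℝ ∞ fun ζ : E => ((unitBump (R * (4 * Real.pi ^ 2 * ‖ζ‖ ^ 2 - 1)) : ℝ) : ℂ) := by
  refine Complex.ofRealCLM.contDiff.comp (unitBump.contDiff.comp ?_)
  exact contDiff_const.mul ((contDiff_const.mul (contDiff_norm_sq ℝ)).sub contDiff_const)

/-- The smooth bump adapted to the shell of thickness `1 / R` around the sphere of
radius `1 / (2 * π)`. -/
def shellBump [FiniteDimensional ℝ E] {R : ℝ} (hR : 0 < R) : 𝓢(E, ℂ) :=
  (hasCompactSupport_shell E hR).toSchwartzMap (contDiff_shell E R)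

variable {E}

theorem shellBump_apply [FiniteDimensional ℝ E] {R : ℝ} (hR : 0 < R) (ζ : E) :
    shellBump E hR ζ = ((unitBump (R * (4 * Real.pi ^ 2 * ‖ζ‖ ^ 2 - 1)) : ℝ) : ℂ) := rfl

theorem hasCompactSupport_shellBump [FiniteDimensional ℝ E] {R : ℝ} (hR : 0 < R) :
    HasCompactSupport (shellBump E hR) := hasCompactSupport_shell E hR

theorem norm_shellBump_le_one [FiniteDimensional ℝ E] {R : ℝ} (hR : 0 < R) (ζ : E) : ‖shellBump E hR ζ‖ ≤ 1 := by
  rw [shellBump_apply, Complex.norm_real, Real.norm_of_nonneg unitBump.nonneg]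
  exact unitBump.le_one

/-- The closed shell that supports `shellBump`. -/
def shell (E : Type*) [NormedAddCommGroup E] (R : ℝ) : Set E :=
  {ζ | |R * (4 * Real.pi ^ 2 * ‖ζ‖ ^ 2 - 1)| ≤ 2}

theorem isClosed_shell {F : Type*} [NormedAddCommGroup F] (R : ℝ) : IsClosed (shell F R) := by
  apply isClosed_le <;> fun_prop

theorem tsupport_shellBump_subset [FiniteDimensional ℝ E] {R : ℝ} (hR : 0 < R) :
    tsupport (shellBump E hR) ⊆ shell E R := by
  refine closure_minimal ?_ (isClosed_shell R)
  intro ζ hζ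
  by_contra hn
  apply hζ
  rw [shellBump_apply, unitBump_eq_zero (le_of_lt (not_le.1 hn)), Complex.ofReal_zero]

theorem norm_le_one_of_mem_shell {F : Type*} [NormedAddCommGroup F] {R : ℝ} (hR : 4 ≤ R) {ζ : F}
    (hζ : ζ ∈ shell F R) :
    ‖ζ‖ ≤ 1 := by
  have h1 := (abs_le.1 (show |R * (4 * Real.pi ^ 2 * ‖ζ‖ ^ 2 - 1)| ≤ 2 from hζ)).2
  have hpi := Real.pi_gt_three
  have h2 : 4 * Real.pi ^ 2 * ‖ζ‖ ^ 2 ≤ 2 := by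
    by_contra! hcon
    nlinarith
  have h3 : 2 ≤ 4 * Real.pi ^ 2 := by nlinarith
  by_contra! hcon
  have h4 : 1 < ‖ζ‖ ^ 2 := by nlinarith
  nlinarith

/-- By the chain rule the derivative is O(R‖ζ‖) on the shell, where ‖ζ‖ ≤ 1 because R ≥ 4, and it
vanishes off the shell. -/
theorem exists_norm_fderiv_shellBump_le [FiniteDimensional ℝ E] : ∃ L : ℝ, 0 < L ∧
    ∀ (R : ℝ) (hR : 4 ≤ R) (ζ : E),
      ‖fderiv ℝ (shellBump E (by linarith : 0 < R)) ζ‖ ≤ L * R := by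
  obtain ⟨L, hL0, hL⟩ := exists_abs_deriv_unitBump_le
  refine ⟨L * (8 * Real.pi ^ 2), by positivity, fun R hR ζ => ?_⟩
  have hR0 : 0 < R := by linarith
  by_cases hζ : ζ ∈ shell E R
  · have h1 : HasFDerivAt (fun ζ : E => R * (4 * Real.pi ^ 2 * ‖ζ‖ ^ 2 - 1))
        (R • ((4 * Real.pi ^ 2) • (2 • innerSL ℝ ζ))) ζ :=
      (((hasStrictFDerivAt_norm_sq ζ).hasFDerivAt.const_mul _).sub_const _).const_mul _
    have h2 : HasDerivAt unitBump
        (deriv unitBump (R * (4 * Real.pi ^ 2 * ‖ζ‖ ^ 2 - 1)))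
        (R * (4 * Real.pi ^ 2 * ‖ζ‖ ^ 2 - 1)) :=
      ((unitBump.contDiff (n := 1)).differentiable one_ne_zero _).hasDerivAt
    have h3 := Complex.ofRealCLM.hasFDerivAt.comp ζ (h2.comp_hasFDerivAt ζ h1)
    have h4 : fderiv ℝ (shellBump E hR0) ζ = _ := HasFDerivAt.fderiv h3
    rw [h4]
    refine (ContinuousLinearMap.opNorm_comp_le _ _).trans ?_
    rw [Complex.ofRealCLM_norm, one_mul, norm_smul, norm_smul, norm_smul,
      Real.norm_of_nonneg hR0.le, Real.norm_of_nonneg (by positivity : 0 ≤ 4 * Real.pi ^ 2)]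
    have h5 : ‖(2 : ℕ) • innerSL ℝ ζ‖ ≤ 2 := by
      rw [two_nsmul, ← two_smul ℝ, norm_smul, innerSL_apply_norm]
      have := norm_le_one_of_mem_shell hR hζ
      norm_num
      exact this
    calc _ ≤ L * (R * (4 * Real.pi ^ 2 * 2)) := by
          gcongr
          exact hL _
      _ = _ := by ring
  · have : fderiv ℝ (shellBump E hR0) ζ = 0 := by
      by_contra hne
      exact hζ (tsupport_shellBump_subset hR0 (support_fderiv_subset ℝ hne))
    rw [this, norm_zero]
    positivity

/-- The right side is the chord over [0, 1] of a convex function of t. This is the upper counterpart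
of Bernoulli's inequality in the volume estimate for the shell. -/
theorem one_add_pow_le {t : ℝ} (h0 : 0 ≤ t) (h1 : t ≤ 1) (n : ℕ) :
    (1 + t) ^ n ≤ 1 + t * (2 ^ n - 1) := by
  induction n with
  | zero => simp
  | succ n ih =>
    have h2 : (1 : ℝ) ≤ 2 ^ n := one_le_pow₀ one_le_two
    calc (1 + t) ^ (n + 1) = (1 + t) ^ n * (1 + t) := pow_succ _ _
      _ ≤ (1 + t * (2 ^ n - 1)) * (1 + t) := by gcongr
      _ ≤ _ := by
        rw [pow_succ]
        nlinarith [mul_nonneg (mul_nonneg h0 (sub_nonneg.2 h2)) (sub_nonneg.2 h1)]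

variable [MeasurableSpace E] [BorelSpace E] [FiniteDimensional ℝ E]

/-- The shell lies between the radii √(1 ± 2/R)/(2π), whose n-th powers differ by O(1/R). -/
theorem exists_volume_shell_le [Nontrivial E] : ∃ C : ℝ, 0 < C ∧ ∀ R : ℝ, 4 ≤ R →
    volume (shell E R) ≤ ENNReal.ofReal (C / R) := by
  set n := Module.finrank ℝ E
  set V := (volume (Metric.ball (0 : E) 1)).toReal
  have hVtop : volume (Metric.ball (0 : E) 1) ≠ ⊤ := measure_ball_lt_top.ne
  have hV0 : 0 ≤ V := ENNReal.toReal_nonneg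
  refine ⟨(2 * 2 ^ n + 2 * n) * V + 1, by positivity, fun R hR => ?_⟩
  have hR0 : 0 < R := by linarith
  set t := 2 / R
  have ht0 : 0 ≤ t := by positivity
  have ht1 : t ≤ 1 / 2 := by
    rw [div_le_iff₀ hR0]; linarith
  have hpi := Real.pi_gt_three
  set a := Real.sqrt (1 - t) / (2 * Real.pi)
  set b := Real.sqrt (1 + t) / (2 * Real.pi)
  have ha0 : 0 ≤ a := by positivity
  have hb0 : 0 ≤ b := by positivity
  have hab : a ≤ b := by
    apply div_le_div_of_nonneg_right _ (by positivity)
    apply Real.sqrt_le_sqrt; linarith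
  have hsub : shell E R ⊆ Metric.closedBall 0 b \ Metric.ball 0 a := by
    intro ζ hζ
    have h1 := abs_le.1 (show |R * (4 * Real.pi ^ 2 * ‖ζ‖ ^ 2 - 1)| ≤ 2 from hζ)
    have h2 : (2 * Real.pi * ‖ζ‖) ^ 2 ≤ 1 + t := by
      have : 4 * Real.pi ^ 2 * ‖ζ‖ ^ 2 - 1 ≤ t := by
        rw [le_div_iff₀ hR0]; linarith [h1.2]
      linarith [mul_pow (2 * Real.pi) ‖ζ‖ 2, mul_pow 2 Real.pi 2]
    have h3 : 1 - t ≤ (2 * Real.pi * ‖ζ‖) ^ 2 := by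
      have : -(4 * Real.pi ^ 2 * ‖ζ‖ ^ 2 - 1) ≤ t := by
        rw [le_div_iff₀ hR0]; linarith [h1.1]
      linarith [mul_pow (2 * Real.pi) ‖ζ‖ 2, mul_pow 2 Real.pi 2]
    simp only [Set.mem_sdiff, Metric.mem_closedBall, dist_zero_right, Metric.mem_ball, not_lt]
    constructor
    · rw [le_div_iff₀ (by positivity)]
      apply Real.le_sqrt_of_sq_le
      linarith [mul_comm ‖ζ‖ (2 * Real.pi)]
    · rw [div_le_iff₀ (by positivity)]
      apply Real.sqrt_le_iff.2
      refine ⟨by positivity, ?_⟩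
      rwa [mul_comm ‖ζ‖ (2 * Real.pi)]
  -- The square roots are removed by √(1 + t) ≤ 1 + t and √(1 - t) ≥ 1 - t; the chord bound and
  -- Bernoulli's inequality then linearize the powers in t.
  have hbn : b ^ n - a ^ n ≤ t * (2 ^ n + n) := by
    have hpin : (1 : ℝ) ≤ (2 * Real.pi) ^ n := one_le_pow₀ (by linarith)
    have h1 : Real.sqrt (1 + t) ^ n ≤ (1 + t) ^ n := by
      gcongr
      apply Real.sqrt_le_iff.2
      constructor <;> nlinarith
    have h2 : (1 - t) ^ n ≤ Real.sqrt (1 - t) ^ n := by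
      apply pow_le_pow_left₀ (by linarith)
      apply Real.le_sqrt_of_sq_le
      nlinarith
    have h3 := one_add_pow_le ht0 (by linarith) n
    have h4 := one_add_mul_le_pow (a := -t) (by linarith) n
    have h5 : Real.sqrt (1 + t) ^ n - Real.sqrt (1 - t) ^ n ≤ t * (2 ^ n + n) := by
      rw [← sub_eq_add_neg] at h4
      nlinarith
    have h6 : 0 ≤ t * (2 ^ n + n) := by positivity
    rw [div_pow, div_pow, ← sub_div, div_le_iff₀ (by positivity)]
    nlinarith
  calc volume (shell E R) ≤ volume (Metric.closedBall (0 : E) b \ Metric.ball 0 a) :=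
        measure_mono hsub
    _ = volume (Metric.closedBall (0 : E) b) - volume (Metric.ball (0 : E) a) :=
        measure_sdiff (Metric.ball_subset_closedBall.trans (Metric.closedBall_subset_closedBall hab))
          measurableSet_ball.nullMeasurableSet measure_ball_lt_top.ne
    _ = ENNReal.ofReal (b ^ n * V) - ENNReal.ofReal (a ^ n * V) := by
        rw [Measure.addHaar_closedBall _ _ hb0, Measure.addHaar_ball _ _ ha0,
          ENNReal.ofReal_mul (by positivity), ENNReal.ofReal_mul (by positivity),
          ENNReal.ofReal_toReal hVtop]
    _ = ENNReal.ofReal (b ^ n * V - a ^ n * V) := (ENNReal.ofReal_sub _ (by positivity)).symm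
    _ ≤ _ := by
        apply ENNReal.ofReal_le_ofReal
        rw [← sub_mul, le_div_iff₀ hR0]
        have : t * R = 2 := by simp only [t]; field_simp
        calc (b ^ n - a ^ n) * V * R ≤ (t * (2 ^ n + n)) * V * R := by gcongr
          _ = (t * R) * (2 ^ n + n) * V := by ring
          _ ≤ _ := by rw [this]; linarith

/-- Under the inverse transform, ∂_v becomes multiplication by -2πi⟨x, v⟩. Plancherel bounds each
directional moment by ∫ ‖∂_v G‖², at most B² times the volume of S; summing over an orthonormal
basis gives ‖x‖². The gain (2π)² ≥ 1 is discarded. -/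
theorem integral_sq_norm_mul_sq_norm_fourierInv_le (G : 𝓢(E, ℂ)) {S : Set E} (hS : IsClosed S)
    (hG : tsupport G ⊆ S) (hSv : volume S ≠ ⊤) {B : ℝ} (hB : ∀ ζ, ‖fderiv ℝ G ζ‖ ≤ B) :
    ∫ x, ‖x‖ ^ 2 * ‖𝓕⁻ G x‖ ^ 2 ≤ Module.finrank ℝ E * (B ^ 2 * volume.real S) := by
  set b := stdOrthonormalBasis ℝ E
  have hone (v : E) (hv : ‖v‖ = 1) :
      Integrable (fun x => (inner ℝ x v) ^ 2 * ‖𝓕⁻ G x‖ ^ 2) ∧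
      ∫ x, (inner ℝ x v) ^ 2 * ‖𝓕⁻ G x‖ ^ 2 ≤ B ^ 2 * volume.real S := by
    have htg : (inner ℝ · v : E → ℝ).HasTemperateGrowth := by fun_prop
    have hpt (x : E) : ‖𝓕⁻ (∂_{v} G) x‖ ^ 2
        = (2 * Real.pi) ^ 2 * ((inner ℝ x v) ^ 2 * ‖𝓕⁻ G x‖ ^ 2) := by
      rw [SchwartzMap.fourierInv_lineDerivOp_eq]
      simp only [smul_apply, SchwartzMap.smulLeftCLM_apply_apply htg, norm_smul,
        norm_neg, norm_mul, Complex.norm_real, Complex.norm_I, mul_pow, Real.norm_eq_abs, sq_abs,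
        RCLike.norm_ofNat]
      ring
    have hI : Integrable (fun x => ‖𝓕⁻ (∂_{v} G) x‖ ^ 2) :=
      (((𝓕⁻ (∂_{v} G)).memLp 2).integrable_norm_pow (p := 2) (by norm_num))
    have hpi0 : (2 * Real.pi) ^ 2 ≠ 0 := by positivity
    have hI' : Integrable (fun x => (inner ℝ x v) ^ 2 * ‖𝓕⁻ G x‖ ^ 2) := by
      have := hI.const_mul (((2 * Real.pi) ^ 2)⁻¹)
      refine this.congr (Filter.Eventually.of_forall fun x => ?_)
      simp only [hpt]
      rw [inv_mul_cancel_left₀ hpi0]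
    refine ⟨hI', ?_⟩
    have hP : ∫ x, ‖𝓕⁻ (∂_{v} G) x‖ ^ 2 = ∫ x, ‖(∂_{v} G) x‖ ^ 2 := by
      rw [← SchwartzMap.integral_norm_sq_fourier (𝓕⁻ (∂_{v} G)),
        FourierTransform.fourier_fourierInv_eq]
    have hle : ∫ x, ‖(∂_{v} G) x‖ ^ 2 ≤ B ^ 2 * volume.real S := by
      have hB0 : 0 ≤ B := (norm_nonneg _).trans (hB 0)
      have hpt2 (x : E) : ‖(∂_{v} G) x‖ ^ 2 ≤ S.indicator (fun _ => B ^ 2) x := by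
        rw [SchwartzMap.lineDerivOp_apply_eq_fderiv]
        by_cases hx : x ∈ S
        · rw [Set.indicator_of_mem hx]
          gcongr
          exact ((fderiv ℝ G x).le_opNorm v).trans (by rw [hv, mul_one]; exact hB x)
        · have : fderiv ℝ G x = 0 := by
            by_contra hne
            exact hx (hG (support_fderiv_subset ℝ hne))
          simp [this, hx]
      calc ∫ x, ‖(∂_{v} G) x‖ ^ 2 ≤ ∫ x, S.indicator (fun _ => B ^ 2) x := by
            apply integral_mono_of_nonneg (Filter.Eventually.of_forall fun x => by positivity)
            · exact (integrable_indicator_iff hS.measurableSet).2 (integrableOn_const hSv)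
            · exact Filter.Eventually.of_forall hpt2
        _ = _ := by
            rw [integral_indicator hS.measurableSet, setIntegral_const, smul_eq_mul, mul_comm]
    have h3 : (2 * Real.pi) ^ 2 * ∫ x, (inner ℝ x v) ^ 2 * ‖𝓕⁻ G x‖ ^ 2 ≤ B ^ 2 * volume.real S := by
      rw [← integral_const_mul]
      simp_rw [← hpt]
      rw [hP]; exact hle
    have h4 : 0 ≤ ∫ x, (inner ℝ x v) ^ 2 * ‖𝓕⁻ G x‖ ^ 2 :=
      integral_nonneg fun x => by positivity
    have hpi : 1 ≤ (2 * Real.pi) ^ 2 := one_le_pow₀ (by linarith [Real.pi_gt_three])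
    exact (le_mul_of_one_le_left h4 hpi).trans h3
  have hsum (x : E) : ‖x‖ ^ 2 * ‖𝓕⁻ G x‖ ^ 2 = ∑ i, (inner ℝ x (b i)) ^ 2 * ‖𝓕⁻ G x‖ ^ 2 := by
    rw [← Finset.sum_mul, ← b.sum_sq_norm_inner_left x]
    simp
  simp_rw [hsum]
  rw [integral_finsetSum _ fun i _ => (hone (b i) (b.orthonormal.1 i)).1]
  calc _ ≤ ∑ i : Fin (Module.finrank ℝ E), B ^ 2 * volume.real S :=
        Finset.sum_le_sum fun i _ => (hone (b i) (b.orthonormal.1 i)).2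
    _ = _ := by simp

/-- The size of the inverse Fourier transform of `shellBump` in `L²`, with the weight `‖x‖²`, and
in `L^∞`. -/
theorem exists_fourierInv_shellBump_bounds [Nontrivial E] : ∃ C : ℝ, 0 < C ∧ ∀ (R : ℝ) (hR : 4 ≤ R),
    (∫ x, ‖𝓕⁻ (shellBump E (by linarith : 0 < R)) x‖ ^ 2 ≤ C / R) ∧
    (∫ x, ‖x‖ ^ 2 * ‖𝓕⁻ (shellBump E (by linarith : 0 < R)) x‖ ^ 2 ≤ C * R) ∧
    ∀ x, ‖𝓕⁻ (shellBump E (by linarith : 0 < R)) x‖ ≤ C / R := by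
  obtain ⟨L, hL0, hL⟩ := exists_norm_fderiv_shellBump_le (E := E)
  obtain ⟨V, hV0, hV⟩ := exists_volume_shell_le (E := E)
  refine ⟨V + Module.finrank ℝ E * (L ^ 2 * V), by positivity, fun R hR => ?_⟩
  have hR0 : 0 < R := by linarith
  have hS := hV R hR
  have hSfin : volume (shell E R) ≠ ⊤ := (hS.trans_lt ENNReal.ofReal_lt_top).ne
  have hSr : volume.real (shell E R) ≤ V / R :=
    ENNReal.toReal_le_of_le_ofReal (by positivity) hS
  set G := shellBump E hR0
  have hpt (x : E) : ‖G x‖ ≤ (shell E R).indicator (fun _ => 1) x := by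
    by_cases hx : x ∈ shell E R
    · rw [Set.indicator_of_mem hx]; exact norm_shellBump_le_one hR0 x
    · have : G x = 0 := by
        by_contra hne
        exact hx (tsupport_shellBump_subset hR0 (subset_closure hne))
      simp [this, hx]
  have hind : ∫ x, (shell E R).indicator (fun _ => (1 : ℝ)) x = volume.real (shell E R) := by
    rw [integral_indicator (isClosed_shell R).measurableSet, setIntegral_const, smul_eq_mul, mul_one]
  have hindI : Integrable ((shell E R).indicator (fun _ => (1 : ℝ))) :=
    (integrable_indicator_iff (isClosed_shell R).measurableSet).2 (integrableOn_const hSfin)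
  have hVC : V / R ≤ (V + Module.finrank ℝ E * (L ^ 2 * V)) / R := by
    gcongr; exact le_add_of_nonneg_right (by positivity)
  -- The three bounds are Plancherel, the moment estimate with derivative bound L R, and the trivial
  -- bound of the inverse transform by the L¹ norm.
  refine ⟨?_, ?_, fun x => ?_⟩
  · refine le_trans ?_ hVC
    rw [← SchwartzMap.integral_norm_sq_fourier, FourierTransform.fourier_fourierInv_eq]
    refine le_trans ?_ hSr
    rw [← hind]
    apply integral_mono_of_nonneg (Filter.Eventually.of_forall fun x => by positivity) hindI
    refine Filter.Eventually.of_forall fun x => le_trans ?_ (hpt x)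
    have := norm_shellBump_le_one hR0 x
    have h0 := norm_nonneg (G x)
    change ‖G x‖ ^ 2 ≤ ‖G x‖
    nlinarith
  · refine (integral_sq_norm_mul_sq_norm_fourierInv_le G (isClosed_shell R)
      (tsupport_shellBump_subset hR0) hSfin (hL R hR)).trans ?_
    calc (Module.finrank ℝ E : ℝ) * ((L * R) ^ 2 * volume.real (shell E R))
        ≤ Module.finrank ℝ E * ((L * R) ^ 2 * (V / R)) := by gcongr
      _ = Module.finrank ℝ E * (L ^ 2 * V) * R := by field_simp
      _ ≤ _ := by gcongr; exact le_add_of_nonneg_left hV0.le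
  · refine le_trans ?_ hVC
    refine le_trans ?_ hSr
    rw [← hind, SchwartzMap.fourierInv_coe, Real.fourierInv_eq]
    refine (norm_integral_le_integral_norm _).trans ?_
    apply integral_mono_of_nonneg (Filter.Eventually.of_forall fun x => norm_nonneg _) hindI
    refine Filter.Eventually.of_forall fun y => le_trans ?_ (hpt y)
    simp

end RadialBumps

/-! ### Weighted Hölder inequality, the L^p norm of one shell, and the logarithmic weight -/

noncomputable section WeightedHolder

open scoped FourierTransform ContDiff LineDeriv

/-- Hölder's inequality, with a weight, for the passage from `L²` to `L^p`, `p < 2`. -/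
theorem eLpNorm_le_of_weight {α F : Type*} [MeasurableSpace α] [NormedAddCommGroup F]
    {μ : Measure α} {f : α → F} {W : α → ℝ} {p : ℝ≥0∞} {a : ℝ} (hpa : (1 / p).toReal = a)
    (ha : 1 / 2 < a) (hf : AEStronglyMeasurable f μ) (hW : AEMeasurable W μ) (hW0 : ∀ x, 0 < W x)
    (hI : Integrable (fun x => ‖f x‖ ^ 2 * W x) μ)
    (hJ : Integrable (fun x => W x ^ (-(1 / (2 * a - 1)))) μ) :
    eLpNorm f p μ ≤ ENNReal.ofReal ((∫ x, ‖f x‖ ^ 2 * W x ∂μ) ^ (1 / 2 : ℝ) *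
      (∫ x, W x ^ (-(1 / (2 * a - 1))) ∂μ) ^ (a - 1 / 2)) := by
  have ha0 : 0 < a := by linarith
  have hptop : p ≠ ⊤ := by rintro rfl; simp at hpa; linarith
  have hp0 : p ≠ 0 := by rintro rfl; simp at hpa; linarith
  have hr : p.toReal = 1 / a := by
    rw [← hpa, ENNReal.toReal_div, ENNReal.toReal_one, one_div_one_div]
  set w : α → ℝ≥0∞ := fun x => ENNReal.ofReal (W x)
  set s : ℝ := 1 / (2 * a - 1)
  have h2a : 0 < 2 * a - 1 := by linarith
  -- With p = 1/a, Hölder is applied with the exponents 2a and its conjugate; s = 1/(2a - 1) is the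
  -- power for which the two occurrences of the weight cancel.
  have hpt (x : α) : ‖f x‖ₑ ^ (1 / a) =
      (‖f x‖ₑ ^ 2 * w x) ^ (1 / (2 * a)) * ((w x) ^ (-s)) ^ (1 - 1 / (2 * a)) := by
    have hw0 : w x ≠ 0 := by simpa [w] using hW0 x
    have hwt : w x ≠ ⊤ := ENNReal.ofReal_ne_top
    rw [ENNReal.mul_rpow_of_nonneg _ _ (by positivity), mul_assoc, ← ENNReal.rpow_mul,
      ← ENNReal.rpow_add _ _ hw0 hwt, ← ENNReal.rpow_natCast, ← ENNReal.rpow_mul]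
    have e1 : 1 / (2 * a) + -s * (1 - 1 / (2 * a)) = 0 := by
      simp only [s]; field_simp; ring
    rw [e1, ENNReal.rpow_zero, mul_one]
    congr 1
    push_cast; field_simp
  rw [eLpNorm_eq_lintegral_rpow_enorm_toReal hp0 hptop, hr, one_div_one_div]
  have e1 : ∫⁻ x, ‖f x‖ₑ ^ 2 * w x ∂μ = ENNReal.ofReal (∫ x, ‖f x‖ ^ 2 * W x ∂μ) := by
    rw [ofReal_integral_eq_lintegral_ofReal hI
      (Filter.Eventually.of_forall fun x => mul_nonneg (by positivity) (hW0 x).le)]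
    refine lintegral_congr fun x => ?_
    rw [ENNReal.ofReal_mul (by positivity), ENNReal.ofReal_pow (norm_nonneg _), ofReal_norm]
  have e2 : ∫⁻ x, w x ^ (-s) ∂μ = ENNReal.ofReal (∫ x, W x ^ (-s) ∂μ) := by
    rw [ofReal_integral_eq_lintegral_ofReal hJ
      (Filter.Eventually.of_forall fun x => Real.rpow_nonneg (hW0 x).le _)]
    refine lintegral_congr fun x => ?_
    rw [ENNReal.ofReal_rpow_of_pos (hW0 x)]
  have n1 : 0 ≤ ∫ x, ‖f x‖ ^ 2 * W x ∂μ :=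
    integral_nonneg fun x => mul_nonneg (by positivity) (hW0 x).le
  have n2 : 0 ≤ ∫ x, W x ^ (-s) ∂μ := integral_nonneg fun x => Real.rpow_nonneg (hW0 x).le _
  have hwm : AEMeasurable w μ := hW.ennreal_ofReal
  have e0 : 1 / (2 * a) ≤ 1 := by
    rw [div_le_one (by linarith)]; linarith
  calc (∫⁻ x, ‖f x‖ₑ ^ (1 / a) ∂μ) ^ a
      ≤ ((∫⁻ x, ‖f x‖ₑ ^ 2 * w x ∂μ) ^ (1 / (2 * a)) *
          (∫⁻ x, w x ^ (-s) ∂μ) ^ (1 - 1 / (2 * a))) ^ a := by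
        simp_rw [hpt]
        gcongr
        exact ENNReal.lintegral_mul_norm_pow_le ((hf.enorm.pow_const 2).mul hwm)
          (hwm.pow_const _) (by positivity) (by linarith) (by ring)
    _ = _ := by
        rw [e1, e2, ENNReal.mul_rpow_of_nonneg _ _ ha0.le, ← ENNReal.rpow_mul, ← ENNReal.rpow_mul,
          ENNReal.ofReal_mul (Real.rpow_nonneg n1 _), ← ENNReal.ofReal_rpow_of_nonneg n1 (by norm_num),
          ← ENNReal.ofReal_rpow_of_nonneg n2 (by linarith)]
        congr 2
        · field_simp
        · field_simp

variable {E : Type*} [NormedAddCommGroup E] [InnerProductSpace ℝ E] [FiniteDimensional ℝ E]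
  [MeasurableSpace E] [BorelSpace E]

theorem SchwartzMap.integrable_norm_sq (f : 𝓢(E, ℂ)) : Integrable fun x => ‖f x‖ ^ 2 :=
  (f.memLp 2).integrable_norm_pow (p := 2) (by norm_num)

theorem SchwartzMap.integrable_sq_norm_mul_norm_sq (f : 𝓢(E, ℂ)) :
    Integrable fun x => ‖x‖ ^ 2 * ‖f x‖ ^ 2 := by
  obtain ⟨C, hC⟩ := f.toBoundedContinuousFunction.bddAbove_range_norm_comp
  have h1 : ∀ x, ‖f x‖ ≤ C := fun x => hC ⟨x, rfl⟩
  refine ((f.integrable_pow_mul volume 2).mul_const C).mono' (by fun_prop)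
    (Filter.Eventually.of_forall fun x => ?_)
  rw [Real.norm_of_nonneg (by positivity), sq ‖f x‖, ← mul_assoc]
  gcongr
  exact h1 x

/-- With the weight (1 + ‖x‖/R)², both second moments contribute O(1/R). The dual weight is (1 +
‖x‖/R)^(-2s) with s = 1/(2a - 1); its integral is a multiple of R^n, finite because `ha'` says n <
2s. -/
theorem exists_eLpNorm_fourierInv_shellBump_le [Nontrivial E] {p : ℝ≥0∞} {a : ℝ}
    (hpa : (1 / p).toReal = a) (ha : 1 / 2 < a) (ha' : Module.finrank ℝ E * (2 * a - 1) < 2) :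
    ∃ C : ℝ, 0 < C ∧ ∀ (R : ℝ) (hR : 4 ≤ R),
      eLpNorm (𝓕⁻ (shellBump E (by linarith : 0 < R)) : 𝓢(E, ℂ)) p volume ≤
        ENNReal.ofReal (C * R ^ (Module.finrank ℝ E * (a - 1 / 2) - 1 / 2)) := by
  obtain ⟨C, hC0, hC⟩ := exists_fourierInv_shellBump_bounds (E := E)
  set n := Module.finrank ℝ E
  have h2a : 0 < 2 * a - 1 := by linarith
  set s : ℝ := 1 / (2 * a - 1)
  have hs : (n : ℝ) < 2 * s := by
    simp only [s]; rw [mul_one_div, lt_div_iff₀ h2a]; exact ha'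
  set K := ∫ x : E, (1 + ‖x‖) ^ (-(2 * s))
  have hK0 : 0 ≤ K := integral_nonneg fun x => by positivity
  refine ⟨(4 * C) ^ (1 / 2 : ℝ) * (K + 1) ^ (a - 1 / 2), by positivity, fun R hR => ?_⟩
  have hR0 : 0 < R := by linarith
  obtain ⟨b1, b2, -⟩ := hC R hR
  set f : 𝓢(E, ℂ) := 𝓕⁻ (shellBump E hR0)
  set W : E → ℝ := fun x => (1 + ‖R⁻¹ • x‖) ^ 2
  have hWc : Continuous W := by fun_prop
  have hW (x : E) : W x ≤ 2 + 2 * (R⁻¹) ^ 2 * ‖x‖ ^ 2 := by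
    simp only [W, norm_smul, Real.norm_of_nonneg (inv_nonneg.2 hR0.le)]
    nlinarith [sq_nonneg (1 - R⁻¹ * ‖x‖)]
  have hs' (x : E) : W x ^ (-s) = (1 + ‖R⁻¹ • x‖) ^ (-(2 * s)) := by
    simp only [W]
    rw [← Real.rpow_natCast, ← Real.rpow_mul (by positivity)]
    congr 1; push_cast; ring
  have hD : Integrable fun x => 2 * ‖f x‖ ^ 2 + 2 * (R⁻¹) ^ 2 * (‖x‖ ^ 2 * ‖f x‖ ^ 2) :=
    (f.integrable_norm_sq.const_mul _).add (f.integrable_sq_norm_mul_norm_sq.const_mul _)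
  have hpt (x : E) : ‖f x‖ ^ 2 * W x ≤ 2 * ‖f x‖ ^ 2 + 2 * (R⁻¹) ^ 2 * (‖x‖ ^ 2 * ‖f x‖ ^ 2) := by
    calc ‖f x‖ ^ 2 * W x ≤ ‖f x‖ ^ 2 * (2 + 2 * (R⁻¹) ^ 2 * ‖x‖ ^ 2) := by gcongr; exact hW x
      _ = _ := by ring
  have hI : Integrable fun x => ‖f x‖ ^ 2 * W x := by
    refine hD.mono' (by fun_prop) (Filter.Eventually.of_forall fun x => ?_)
    rw [Real.norm_of_nonneg (by positivity)]
    exact hpt x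
  have hJ : Integrable fun x => W x ^ (-s) := by
    simp_rw [hs']
    exact (integrable_one_add_norm hs).comp_smul (inv_ne_zero hR0.ne')
  refine (eLpNorm_le_of_weight hpa ha f.continuous.aestronglyMeasurable
    hWc.measurable.aemeasurable (fun x => by positivity) hI hJ).trans ?_
  apply ENNReal.ofReal_le_ofReal
  have i1 : ∫ x, ‖f x‖ ^ 2 * W x ≤ 4 * C * R⁻¹ := by
    calc ∫ x, ‖f x‖ ^ 2 * W x ≤ _ := integral_mono hI hD hpt
      _ = 2 * (∫ x, ‖f x‖ ^ 2) + 2 * (R⁻¹) ^ 2 * ∫ x, ‖x‖ ^ 2 * ‖f x‖ ^ 2 := by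
          rw [integral_add (f.integrable_norm_sq.const_mul _)
            (f.integrable_sq_norm_mul_norm_sq.const_mul _), integral_const_mul, integral_const_mul]
      _ ≤ 2 * (C / R) + 2 * (R⁻¹) ^ 2 * (C * R) := by gcongr
      _ = _ := by field_simp; ring
  have i2 : ∫ x, W x ^ (-s) = R ^ n * K := by
    simp_rw [hs']
    rw [Measure.integral_comp_inv_smul_of_nonneg volume
      (fun x : E => (1 + ‖x‖) ^ (-(2 * s))) hR0.le, smul_eq_mul]
  have hi0 : 0 ≤ ∫ x, ‖f x‖ ^ 2 * W x := integral_nonneg fun x => by positivity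
  rw [i2]
  calc _ ≤ (4 * C * R⁻¹) ^ (1 / 2 : ℝ) * (R ^ n * (K + 1)) ^ (a - 1 / 2) := by
        gcongr
        · linarith
    _ = _ := by
        rw [Real.mul_rpow (x := 4 * C) (by positivity) (by positivity),
          Real.mul_rpow (x := R ^ n) (by positivity) (by positivity), ← Real.rpow_natCast R n, ← Real.rpow_mul hR0.le,
          Real.inv_rpow hR0.le, Real.rpow_sub hR0]
        ring

/-- Partial fractions: a primitive is R/(R - 1) · log((1 + r)/(R + r)), which tends to 0 at
infinity. -/
theorem integral_inv_mul_inv_eq {R : ℝ} (hR : 1 < R) :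
    IntegrableOn (fun r : ℝ => ((1 + r) * (1 + r / R))⁻¹) (Set.Ioi 0) ∧
    ∫ r in Set.Ioi (0 : ℝ), ((1 + r) * (1 + r / R))⁻¹ = R / (R - 1) * Real.log R := by
  set g : ℝ → ℝ := fun r => R / (R - 1) * (Real.log (1 + r) - Real.log (R + r))
  have hd (r : ℝ) (hr : r ∈ Set.Ici (0 : ℝ)) : HasDerivAt g ((1 + r) * (1 + r / R))⁻¹ r := by
    have hr0 : (0 : ℝ) ≤ r := hr
    have h1 : HasDerivAt (fun r => Real.log (1 + r)) (1 / (1 + r)) r :=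
      ((hasDerivAt_id r).const_add 1).log (by simp; linarith)
    have h2 : HasDerivAt (fun r => Real.log (R + r)) (1 / (R + r)) r :=
      ((hasDerivAt_id r).const_add R).log (by simp; linarith)
    convert! (h1.sub h2).const_mul (R / (R - 1)) using 1
    have : R - 1 ≠ 0 := by linarith
    have : 1 + r ≠ 0 := by linarith
    have : R + r ≠ 0 := by linarith
    have : R ≠ 0 := by linarith
    field_simp
    ring
  have hlim : Filter.Tendsto g Filter.atTop (nhds 0) := by
    have h1 : Filter.Tendsto (fun r : ℝ => 1 - (R - 1) / (R + r)) Filter.atTop (nhds (1 - 0)) := by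
      apply tendsto_const_nhds.sub
      exact tendsto_const_nhds.div_atTop (Filter.tendsto_atTop_add_const_left _ _ Filter.tendsto_id)
    have h2 := (h1.log (by norm_num)).const_mul (R / (R - 1))
    simp only [sub_zero, Real.log_one, mul_zero] at h2
    refine h2.congr' ?_
    filter_upwards [Filter.eventually_ge_atTop 0] with r hr
    simp only [g]
    rw [← Real.log_div (by linarith) (by linarith)]
    congr 2
    have : R + r ≠ 0 := by linarith
    field_simp
    ring
  have hpos (r : ℝ) (hr : r ∈ Set.Ioi (0 : ℝ)) : 0 ≤ ((1 + r) * (1 + r / R))⁻¹ := by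
    have hr0 : (0 : ℝ) < r := hr
    positivity
  refine ⟨integrableOn_Ioi_deriv_of_nonneg' hd hpos hlim, ?_⟩
  rw [integral_Ioi_of_hasDerivAt_of_nonneg' hd hpos hlim]
  simp [g]

/-- In polar coordinates the density r^(n-1) is absorbed by n - 1 of the n factors, as r ≤ (1 + r)(1
+ r/R). The one left over behaves like 1/r for 1 ≤ r ≤ R and integrates to O(log R). -/
theorem exists_integral_log_weight_le [Nontrivial E] : ∃ C : ℝ, 0 < C ∧ ∀ R : ℝ, 4 ≤ R →
    Integrable (fun x : E => ((1 + ‖x‖) * (1 + ‖x‖ / R)) ^ (-(Module.finrank ℝ E : ℝ))) ∧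
    ∫ x : E, ((1 + ‖x‖) * (1 + ‖x‖ / R)) ^ (-(Module.finrank ℝ E : ℝ)) ≤ C * Real.log R := by
  set n := Module.finrank ℝ E with hn
  have hn1 : 0 < n := Module.finrank_pos
  refine ⟨n * volume.real (Metric.ball (0 : E) 1) * 2 + 1, by positivity, fun R hR => ?_⟩
  have hR0 : 0 < R := by linarith
  have hint : Integrable (fun x : E => ((1 + ‖x‖) * (1 + ‖x‖ / R)) ^ (-(n : ℝ))) := by
    have h2n : (n : ℝ) < 2 * n := by
      have : (0 : ℝ) < n := by exact_mod_cast hn1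
      linarith
    refine ((integrable_one_add_norm (μ := (volume : Measure E)) h2n).const_mul (R ^ n)).mono'
      (by
        apply Measurable.aestronglyMeasurable
        fun_prop) (Filter.Eventually.of_forall fun x => ?_)
    rw [Real.norm_of_nonneg (by positivity), Real.rpow_neg (by positivity),
      Real.rpow_neg (by positivity), Real.rpow_natCast,
      show (2 * (n : ℝ)) = ((2 * n : ℕ) : ℝ) by push_cast; ring, Real.rpow_natCast, pow_mul,
      ← div_eq_mul_inv, ← div_pow, ← inv_pow]
    gcongr
    rw [inv_le_comm₀ (by positivity) (by positivity), inv_div, div_le_iff₀ hR0, sq, mul_assoc]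
    gcongr
    rw [add_mul, div_mul_cancel₀ _ hR0.ne']
    linarith
  refine ⟨hint, ?_⟩
  have hF := integral_fun_norm_addHaar (volume : Measure E)
    (fun r : ℝ => ((1 + r) * (1 + r / R)) ^ (-(n : ℝ)))
  have hI := (integrable_fun_norm_addHaar (volume : Measure E)
    (f := fun r : ℝ => ((1 + r) * (1 + r / R)) ^ (-(n : ℝ)))).1 hint
  obtain ⟨k1, k2⟩ := integral_inv_mul_inv_eq (by linarith : 1 < R)
  have hlog : 0 < Real.log R := Real.log_pos (by linarith)
  have hle : ∫ r in Set.Ioi (0 : ℝ), r ^ (n - 1) • ((1 + r) * (1 + r / R)) ^ (-(n : ℝ)) ≤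
      2 * Real.log R := by
    calc _ ≤ ∫ r in Set.Ioi (0 : ℝ), ((1 + r) * (1 + r / R))⁻¹ := by
          refine setIntegral_mono_on hI k1 measurableSet_Ioi fun r hr => ?_
          have hr0 : (0 : ℝ) < r := hr
          rw [Real.rpow_neg (by positivity), Real.rpow_natCast, smul_eq_mul, ← div_eq_mul_inv,
            div_le_iff₀ (by positivity)]
          obtain ⟨k, hk⟩ : ∃ k, n = k + 1 := ⟨n - 1, by omega⟩
          rw [hk, Nat.add_sub_cancel, pow_succ, mul_comm _ ((1 + r) * (1 + r / R)),
            inv_mul_cancel_left₀ (by positivity)]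
          gcongr
          have : 0 ≤ r / R := by positivity
          nlinarith
      _ = R / (R - 1) * Real.log R := k2
      _ ≤ _ := by
          gcongr
          rw [div_le_iff₀ (by linarith)]; linarith
  rw [hF, nsmul_eq_mul, smul_eq_mul]
  calc _ ≤ (n : ℝ) * (volume.real (Metric.ball (0 : E) 1) * (2 * Real.log R)) := by gcongr
    _ ≤ _ := by nlinarith

end WeightedHolder

/-! ### The critical exponent: sums of dyadic shells -/

noncomputable section LogarithmicBump

open scoped FourierTransform ContDiff LineDeriv

/-- The exponent is |i - j|, written without truncated subtraction. Off-diagonal decay is geometric,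
so the double sum grows linearly in J rather than quadratically. -/
theorem sum_half_pow_dist_le (J : ℕ) :
    ∑ i ∈ Finset.range J, ∑ j ∈ Finset.range J, (1 / 2 : ℝ) ^ (max i j - min i j) ≤ 4 * J := by
  have hrow (J : ℕ) : ∑ i ∈ Finset.range J, (1 / 2 : ℝ) ^ (J - i) ≤ 1 := by
    induction J with
    | zero => simp
    | succ J ih =>
      rw [Finset.sum_range_succ]
      have : ∑ i ∈ Finset.range J, (1 / 2 : ℝ) ^ (J + 1 - i) =
          1 / 2 * ∑ i ∈ Finset.range J, (1 / 2 : ℝ) ^ (J - i) := by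
        rw [Finset.mul_sum]
        refine Finset.sum_congr rfl fun i hi => ?_
        rw [Nat.succ_sub (Finset.mem_range.1 hi).le, pow_succ, mul_comm]
      rw [this]
      norm_num
      linarith
  induction J with
  | zero => simp
  | succ J ih =>
    rw [Finset.sum_range_succ, Finset.sum_range_succ]
    simp_rw [Finset.sum_range_succ]
    rw [Finset.sum_add_distrib]
    have h1 : ∑ i ∈ Finset.range J, (1 / 2 : ℝ) ^ (max i J - min i J) ≤ 1 := by
      refine le_trans (le_of_eq (Finset.sum_congr rfl fun i hi => ?_)) (hrow J)
      rw [max_eq_right (Finset.mem_range.1 hi).le, min_eq_left (Finset.mem_range.1 hi).le]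
    have h2 : ∑ i ∈ Finset.range J, (1 / 2 : ℝ) ^ (max J i - min J i) ≤ 1 := by
      simpa only [max_comm, min_comm] using h1
    simp only [max_self, min_self, Nat.sub_self, pow_zero]
    push_cast
    linarith

variable {E : Type*} [NormedAddCommGroup E] [InnerProductSpace ℝ E] [FiniteDimensional ℝ E]

variable (E) in
/-- A superposition of dyadic shell bumps: a smooth version of the logarithm of the distance to the
sphere of radius `1 / (2 * π)`. -/
def logBump (J : ℕ) : 𝓢(E, ℂ) :=
  ∑ i ∈ Finset.range J, shellBump E (by positivity : (0 : ℝ) < 4 ^ (i + 1))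

variable [MeasurableSpace E] [BorelSpace E]

/-- Almost orthogonality of dyadic pieces with respect to the weight `(1 + ‖x‖) (1 + ‖x‖ / R)`. -/
theorem integral_sq_sum_mul_weight_le {C : ℝ} {J : ℕ} (f : ℕ → 𝓢(E, ℂ))
    (h1 : ∀ i, ∫ x, ‖f i x‖ ^ 2 ≤ C / 4 ^ i) (h2 : ∀ i, ∫ x, ‖x‖ ^ 2 * ‖f i x‖ ^ 2 ≤ C * 4 ^ i) :
    Integrable (fun x => ‖∑ i ∈ Finset.range J, f i x‖ ^ 2 * ((1 + ‖x‖) * (1 + ‖x‖ / 4 ^ J))) ∧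
    ∫ x, ‖∑ i ∈ Finset.range J, f i x‖ ^ 2 * ((1 + ‖x‖) * (1 + ‖x‖ / 4 ^ J)) ≤ 20 * C * J := by
  have hC : 0 ≤ C := by
    have := (integral_nonneg fun x => by positivity : 0 ≤ ∫ x, ‖f 0 x‖ ^ 2).trans (h1 0)
    simpa using this
  set s := Finset.range J
  have hR1 : (1 : ℝ) ≤ 4 ^ J := one_le_pow₀ (by norm_num)
  -- Majorant of 2‖x‖‖f_i‖‖f_j‖ by the arithmetic-geometric mean inequality. The weight 2^(i+j) is
  -- the geometric mean of 4^i and 4^j, and the moment ‖x‖² falls on the smaller index, so that both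
  -- terms integrate to at most C · 2^(-|i-j|).
  set P : ℕ → ℕ → E → ℝ := fun i j x =>
    (1 / 2) ^ (i + j) * (‖x‖ ^ 2 * ‖f (min i j) x‖ ^ 2) + 2 ^ (i + j) * ‖f (max i j) x‖ ^ 2
  set Q : E → ℝ := fun x => 2 * ∑ i ∈ s, ∑ j ∈ s, P i j x + (J * ∑ i ∈ s, ‖f i x‖ ^ 2 +
    J * (1 / 4 ^ J) * ∑ i ∈ s, ‖x‖ ^ 2 * ‖f i x‖ ^ 2)
  have IP (i j : ℕ) : Integrable (P i j) :=
    ((f _).integrable_sq_norm_mul_norm_sq.const_mul _).add ((f _).integrable_norm_sq.const_mul _)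
  have IP1 (i : ℕ) : Integrable (fun x => ∑ j ∈ s, P i j x) :=
    integrable_finsetSum _ fun j _ => IP i j
  have IP2 : Integrable (fun x => ∑ i ∈ s, ∑ j ∈ s, P i j x) :=
    integrable_finsetSum _ fun i _ => IP1 i
  have I1 : Integrable (fun x => ∑ i ∈ s, ‖f i x‖ ^ 2) :=
    integrable_finsetSum _ fun i _ => (f i).integrable_norm_sq
  have I2 : Integrable (fun x => ∑ i ∈ s, ‖x‖ ^ 2 * ‖f i x‖ ^ 2) :=
    integrable_finsetSum _ fun i _ => (f i).integrable_sq_norm_mul_norm_sq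
  have I12 : Integrable (fun x => J * ∑ i ∈ s, ‖f i x‖ ^ 2 +
      J * (1 / 4 ^ J) * ∑ i ∈ s, ‖x‖ ^ 2 * ‖f i x‖ ^ 2) :=
    (I1.const_mul _).add (I2.const_mul _)
  have IQ : Integrable Q := (IP2.const_mul _).add I12
  have hpt (x : E) : ‖∑ i ∈ s, f i x‖ ^ 2 * ((1 + ‖x‖) * (1 + ‖x‖ / 4 ^ J)) ≤ Q x := by
    set u : ℕ → ℝ := fun i => ‖f i x‖
    have hu (i : ℕ) : 0 ≤ u i := norm_nonneg _
    have hx := norm_nonneg x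
    have a1 : ‖∑ i ∈ s, f i x‖ ^ 2 ≤ (∑ i ∈ s, u i) ^ 2 := by
      gcongr; exact norm_sum_le _ _
    have a2 : (∑ i ∈ s, u i) ^ 2 ≤ J * ∑ i ∈ s, u i ^ 2 := by
      simpa [s] using sq_sum_le_card_mul_sum_sq (s := s) (f := u)
    have a3 : (∑ i ∈ s, u i) ^ 2 * ‖x‖ ≤ ∑ i ∈ s, ∑ j ∈ s, P i j x := by
      rw [sq, Finset.sum_mul_sum, Finset.sum_mul]
      refine Finset.sum_le_sum fun i _ => ?_
      rw [Finset.sum_mul]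
      refine Finset.sum_le_sum fun j _ => ?_
      have e : u i * u j = u (min i j) * u (max i j) := by
        rcases le_total i j with h | h
        · rw [min_eq_left h, max_eq_right h]
        · rw [min_eq_right h, max_eq_left h, mul_comm]
      rw [e]
      change _ ≤ (1 / 2) ^ (i + j) * (‖x‖ ^ 2 * u (min i j) ^ 2) + 2 ^ (i + j) * u (max i j) ^ 2
      set l : ℝ := 2 ^ (i + j)
      have hl : 0 < l := by positivity
      have hl' : (1 / 2 : ℝ) ^ (i + j) = l⁻¹ := by rw [one_div, inv_pow]
      rw [hl']
      set A := u (min i j)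
      set B := u (max i j)
      have k : 0 ≤ l⁻¹ * (‖x‖ * A - l * B) ^ 2 := by positivity
      have k2 : l⁻¹ * (‖x‖ * A - l * B) ^ 2
          = l⁻¹ * (‖x‖ ^ 2 * A ^ 2) + l * B ^ 2 - 2 * (A * B * ‖x‖) := by
        field_simp; ring
      have k3 : 0 ≤ A * B * ‖x‖ := mul_nonneg (mul_nonneg (hu _) (hu _)) hx
      linarith
    have a4 : (1 + ‖x‖) * (1 + ‖x‖ / 4 ^ J) ≤ 1 + 2 * ‖x‖ + (1 / 4 ^ J) * ‖x‖ ^ 2 := by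
      -- Only the linear term 2‖x‖ needs almost orthogonality. For the terms 1 and ‖x‖²/4^J,
      -- Cauchy–Schwarz with its loss of J is enough, since the norms form geometric series.
      have : ‖x‖ / 4 ^ J ≤ ‖x‖ := div_le_self hx hR1
      have e : (1 + ‖x‖) * (1 + ‖x‖ / 4 ^ J)
        = 1 + ‖x‖ + ‖x‖ / 4 ^ J + (1 / 4 ^ J) * ‖x‖ ^ 2 := by ring
      linarith
    calc _ ≤ (∑ i ∈ s, u i) ^ 2 * (1 + 2 * ‖x‖ + (1 / 4 ^ J) * ‖x‖ ^ 2) := by gcongr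
      _ = 2 * ((∑ i ∈ s, u i) ^ 2 * ‖x‖) + ((∑ i ∈ s, u i) ^ 2
          + (∑ i ∈ s, u i) ^ 2 * ((1 / 4 ^ J) * ‖x‖ ^ 2)) := by ring
      _ ≤ 2 * (∑ i ∈ s, ∑ j ∈ s, P i j x) + (J * ∑ i ∈ s, u i ^ 2
          + (J * ∑ i ∈ s, u i ^ 2) * ((1 / 4 ^ J) * ‖x‖ ^ 2)) := by gcongr
      _ = Q x := by
          simp only [Q, ← Finset.mul_sum, u]
          ring
  have hI : Integrable (fun x => ‖∑ i ∈ s, f i x‖ ^ 2 * ((1 + ‖x‖) * (1 + ‖x‖ / 4 ^ J))) := by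
    refine IQ.mono' (by fun_prop) (Filter.Eventually.of_forall fun x => ?_)
    rw [Real.norm_of_nonneg (by positivity)]
    exact hpt x
  refine ⟨hI, (integral_mono hI IQ hpt).trans ?_⟩
  have eP (i j : ℕ) : ∫ x, P i j x ≤ 2 * C * (1 / 2) ^ (max i j - min i j) := by
    simp only [P]
    rw [integral_add ((f _).integrable_sq_norm_mul_norm_sq.const_mul _)
      ((f _).integrable_norm_sq.const_mul _), integral_const_mul, integral_const_mul]
    obtain ⟨k, hk⟩ : ∃ k, max i j = min i j + k := ⟨_, (Nat.add_sub_cancel' min_le_max).symm⟩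
    have hs : i + j = 2 * min i j + k := by
      have := min_add_max i j; omega
    rw [hs, hk, Nat.add_sub_cancel_left]
    set a := min i j
    have e4 : (4 : ℝ) ^ a = 2 ^ a * 2 ^ a := by rw [← mul_pow]; norm_num
    have e4k : (4 : ℝ) ^ k = 2 ^ k * 2 ^ k := by rw [← mul_pow]; norm_num
    calc _ ≤ (1 / 2 : ℝ) ^ (2 * a + k) * (C * 4 ^ a) + 2 ^ (2 * a + k) * (C / 4 ^ (a + k)) := by
          gcongr
          · exact h2 a
          · exact h1 (a + k)
      _ = _ := by
          rw [pow_add, pow_add, pow_add, two_mul, pow_add, pow_add, e4, e4k, one_div_pow, one_div_pow]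
          field_simp
          norm_num
  have g1 : ∫ x, ∑ i ∈ s, ∑ j ∈ s, P i j x ≤ 2 * C * (4 * J) := by
    rw [integral_finsetSum _ fun i _ => IP1 i]
    calc _ ≤ ∑ i ∈ s, ∑ j ∈ s, 2 * C * (1 / 2 : ℝ) ^ (max i j - min i j) := by
          refine Finset.sum_le_sum fun i _ => ?_
          rw [integral_finsetSum _ fun j _ => IP i j]
          exact Finset.sum_le_sum fun j _ => eP i j
      _ = 2 * C * ∑ i ∈ s, ∑ j ∈ s, (1 / 2 : ℝ) ^ (max i j - min i j) := by
          simp_rw [Finset.mul_sum]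
      _ ≤ _ := by gcongr; exact sum_half_pow_dist_le J
  have g2 : ∫ x, ∑ i ∈ s, ‖f i x‖ ^ 2 ≤ 2 * C := by
    rw [integral_finsetSum _ fun i _ => (f i).integrable_norm_sq]
    calc _ ≤ ∑ i ∈ s, C / 4 ^ i := Finset.sum_le_sum fun i _ => h1 i
      _ ≤ ∑ i ∈ s, C * (1 / 2) ^ i := by
          refine Finset.sum_le_sum fun i _ => ?_
          rw [div_eq_mul_inv, ← inv_pow]
          gcongr
          norm_num
      _ = C * ∑ i ∈ s, (1 / 2) ^ i := by rw [Finset.mul_sum]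
      _ ≤ C * 2 := by
          gcongr
          exact sum_geometric_two_le J
      _ = _ := mul_comm _ _
  have g3 : ∫ x, ∑ i ∈ s, ‖x‖ ^ 2 * ‖f i x‖ ^ 2 ≤ C * 4 ^ J := by
    rw [integral_finsetSum _ fun i _ => (f i).integrable_sq_norm_mul_norm_sq]
    calc _ ≤ ∑ i ∈ s, C * 4 ^ i := Finset.sum_le_sum fun i _ => h2 i
      _ = C * ∑ i ∈ s, 4 ^ i := by rw [Finset.mul_sum]
      _ ≤ C * 4 ^ J := by
          gcongr
          rw [geom_sum_eq (by norm_num)]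
          rw [div_le_iff₀ (by norm_num)]
          linarith
  have hJ0 : (0 : ℝ) ≤ J := Nat.cast_nonneg J
  simp only [Q]
  rw [integral_add (IP2.const_mul _) I12,
    integral_add (I1.const_mul _) (I2.const_mul _), integral_const_mul, integral_const_mul,
    integral_const_mul]
  calc _ ≤ 2 * (2 * C * (4 * J)) + (J * (2 * C) + J * (1 / 4 ^ J) * (C * 4 ^ J)) := by gcongr
    _ = 19 * C * J := by field_simp; ring
    _ ≤ _ := by gcongr; norm_num

/-- At this exponent 1/(2a - 1) = n, so the dual weight has integral O(log 4^J) = O(J). With the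
weighted L² bound O(J) this gives J^(1/2) · J^(a - 1/2) = J^a. -/
theorem exists_eLpNorm_fourierInv_logBump_le [Nontrivial E] {p : ℝ≥0∞} {a : ℝ}
    (hpa : (1 / p).toReal = a)
    (ha : a = (Module.finrank ℝ E + 1) / (2 * Module.finrank ℝ E)) :
    ∃ C : ℝ, 0 < C ∧ ∀ J : ℕ, 1 ≤ J →
      eLpNorm (𝓕⁻ (logBump E J) : 𝓢(E, ℂ)) p volume ≤ ENNReal.ofReal (C * (J : ℝ) ^ a) := by
  obtain ⟨C, hC0, hC⟩ := exists_fourierInv_shellBump_bounds (E := E)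
  obtain ⟨D, hD0, hD⟩ := exists_integral_log_weight_le (E := E)
  set n := Module.finrank ℝ E
  have hn0 : (0 : ℝ) < n := by
    have : 0 < n := Module.finrank_pos
    exact_mod_cast this
  have ha1 : a - 1 / 2 = 1 / (2 * n) := by rw [ha]; field_simp; ring
  have ha2 : 1 / 2 < a := by
    have : 0 < 1 / (2 * (n : ℝ)) := by positivity
    linarith
  have hs : -(1 / (2 * a - 1)) = -(n : ℝ) := by
    have : 2 * a - 1 = 1 / n := by rw [ha]; field_simp; ring
    rw [this, one_div_one_div]
  set f : ℕ → 𝓢(E, ℂ) := fun i => 𝓕⁻ (shellBump E (by positivity : (0 : ℝ) < 4 ^ (i + 1)))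
  -- The scales start at 4 rather than 1 to meet the condition 4 ≤ R; this costs the factor 4 in
  -- `h1` and `h2`.
  have h4 (i : ℕ) : (4 : ℝ) ≤ 4 ^ (i + 1) := le_self_pow₀ (by norm_num) (by omega)
  have h1 (i : ℕ) : ∫ x, ‖f i x‖ ^ 2 ≤ 4 * C / 4 ^ i := by
    refine (hC _ (h4 i)).1.trans ?_
    gcongr
    · linarith
    · norm_num
    · omega
  have h2 (i : ℕ) : ∫ x, ‖x‖ ^ 2 * ‖f i x‖ ^ 2 ≤ 4 * C * 4 ^ i := by
    refine (hC _ (h4 i)).2.1.trans (le_of_eq ?_)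
    rw [pow_succ]; ring
  have hF (J : ℕ) (x : E) : (𝓕⁻ (logBump E J) : 𝓢(E, ℂ)) x = ∑ i ∈ Finset.range J, f i x := by
    have : (𝓕⁻ (logBump E J) : 𝓢(E, ℂ)) = ∑ i ∈ Finset.range J, f i := by
      simp only [logBump, f]
      exact map_sum (FourierTransform.fourierCLE ℂ 𝓢(E, ℂ)).symm _ _
    rw [this, sum_apply]
  refine ⟨(80 * C) ^ (1 / 2 : ℝ) * (D * Real.log 4) ^ (a - 1 / 2),
    by have := Real.log_pos (by norm_num : (1 : ℝ) < 4); positivity, fun J hJ => ?_⟩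
  have hJ0 : (0 : ℝ) < J := by exact_mod_cast hJ
  have hlog := Real.log_pos (by norm_num : (1 : ℝ) < 4)
  obtain ⟨k1, k2⟩ := integral_sq_sum_mul_weight_le (J := J) f h1 h2
  obtain ⟨l1, l2⟩ := hD (4 ^ J) (le_self_pow₀ (by norm_num) (by omega))
  rw [Real.log_pow] at l2
  have hW : Continuous fun x : E => (1 + ‖x‖) * (1 + ‖x‖ / 4 ^ J) := by fun_prop
  refine (eLpNorm_le_of_weight (W := fun x => (1 + ‖x‖) * (1 + ‖x‖ / 4 ^ J)) hpa ha2
    (SchwartzMap.continuous _).aestronglyMeasurable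
    hW.measurable.aemeasurable (fun x => by positivity) ?_ ?_).trans ?_
  · simp_rw [hF]; exact k1
  · simp_rw [hs]; exact l1
  · apply ENNReal.ofReal_le_ofReal
    simp_rw [hF, hs]
    have n1 : 0 ≤ ∫ x, ‖∑ i ∈ Finset.range J, f i x‖ ^ 2 * ((1 + ‖x‖) * (1 + ‖x‖ / 4 ^ J)) :=
      integral_nonneg fun x => by positivity
    have n2 : 0 ≤ ∫ x : E, ((1 + ‖x‖) * (1 + ‖x‖ / 4 ^ J)) ^ (-(n : ℝ)) :=
      integral_nonneg fun x => by positivity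
    have ha3 : 0 ≤ a - 1 / 2 := by linarith
    calc _ ≤ (80 * C * J) ^ (1 / 2 : ℝ) * (D * Real.log 4 * J) ^ (a - 1 / 2) := by
          gcongr
          · linarith
          · linarith
      _ = _ := by
          rw [Real.mul_rpow (x := 80 * C) (by positivity) hJ0.le,
            Real.mul_rpow (x := D * Real.log 4) (by positivity) hJ0.le]
          have : (J : ℝ) ^ a = (J : ℝ) ^ (1 / 2 : ℝ) * (J : ℝ) ^ (a - 1 / 2) := by
            rw [← Real.rpow_add hJ0]; congr 1; ring
          rw [this]; ring

end LogarithmicBump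

/-! ### Orthogonal coordinate blocks and tensor products -/

noncomputable section CoordinateSplitting

open scoped FourierTransform ContDiff LineDeriv

variable {ι : Type*} [Fintype ι]

/-- The projection of `ℝ^ι` to the coordinates that satisfy `P`. -/
def coordProj (P : ι → Prop) [DecidablePred P] :
    EuclideanSpace ℝ ι →L[ℝ] EuclideanSpace ℝ {i // P i} :=
  LinearMap.toContinuousLinearMap
    { toFun := fun z => WithLp.toLp 2 fun i => z i
      map_add' := fun _ _ => rfl
      map_smul' := fun _ _ => rfl }

theorem coordProj_apply (P : ι → Prop) [DecidablePred P] (z : EuclideanSpace ℝ ι) (i : {i // P i}) :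
    coordProj P z i = z i := rfl

variable (P : ι → Prop) [DecidablePred P]

theorem inner_eq_add_coordProj (z w : EuclideanSpace ℝ ι) :
    inner ℝ z w = inner ℝ (coordProj P z) (coordProj P w) +
      inner ℝ (coordProj (fun i => ¬ P i) z) (coordProj (fun i => ¬ P i) w) := by
  simp only [PiLp.inner_apply, coordProj_apply]
  exact (Fintype.sum_subtype_add_sum_subtype P fun i => inner ℝ (z i) (w i)).symm

theorem norm_sq_eq_add_coordProj (z : EuclideanSpace ℝ ι) :
    ‖z‖ ^ 2 = ‖coordProj P z‖ ^ 2 + ‖coordProj (fun i => ¬ P i) z‖ ^ 2 := by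
  simp only [← real_inner_self_eq_norm_sq]
  exact inner_eq_add_coordProj P z z

/-- The splitting of `ℝ^ι` into the coordinates that satisfy `P` and the others. -/
def coordSplit : EuclideanSpace ℝ ι ≃ᵐ
    EuclideanSpace ℝ {i // P i} × EuclideanSpace ℝ {i // ¬ P i} :=
  (MeasurableEquiv.toLp 2 (ι → ℝ)).symm.trans
    ((MeasurableEquiv.piEquivPiSubtypeProd (fun _ : ι => ℝ) P).trans
      ((MeasurableEquiv.toLp 2 _).prodCongr (MeasurableEquiv.toLp 2 _)))

theorem coordSplit_apply (z : EuclideanSpace ℝ ι) :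
    coordSplit P z = (coordProj P z, coordProj (fun i => ¬ P i) z) := rfl

theorem measurePreserving_coordSplit : MeasurePreserving (coordSplit P) := by
  refine (EuclideanSpace.volume_preserving_symm_measurableEquiv_toLp ι).trans ?_
  refine (volume_preserving_piEquivPiSubtypeProd (fun _ : ι => ℝ) P).trans ?_
  exact (EuclideanSpace.volume_preserving_symm_measurableEquiv_toLp _).symm.prod
    (EuclideanSpace.volume_preserving_symm_measurableEquiv_toLp _).symm

theorem integral_coordProj_mul (u : EuclideanSpace ℝ {i // P i} → ℂ)
    (v : EuclideanSpace ℝ {i // ¬ P i} → ℂ) :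
    ∫ z : EuclideanSpace ℝ ι, u (coordProj P z) * v (coordProj (fun i => ¬ P i) z) =
      (∫ x, u x) * ∫ y, v y := by
  rw [← integral_prod_mul]
  exact (measurePreserving_coordSplit P).integral_comp (coordSplit P).measurableEmbedding
    (fun w => u w.1 * v w.2)

theorem lintegral_coordProj_mul {u : EuclideanSpace ℝ {i // P i} → ℝ≥0∞}
    {v : EuclideanSpace ℝ {i // ¬ P i} → ℝ≥0∞} (hu : Measurable u) (hv : Measurable v) :
    ∫⁻ z : EuclideanSpace ℝ ι, u (coordProj P z) * v (coordProj (fun i => ¬ P i) z) =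
      (∫⁻ x, u x) * ∫⁻ y, v y := by
  rw [← lintegral_prod_mul hu.aemeasurable hv.aemeasurable]
  exact (measurePreserving_coordSplit P).lintegral_comp (f := fun w => u w.1 * v w.2)
    ((hu.comp measurable_fst).mul (hv.comp measurable_snd))

theorem hasCompactSupport_coordProj_mul {u : EuclideanSpace ℝ {i // P i} → ℂ}
    {v : EuclideanSpace ℝ {i // ¬ P i} → ℂ} (hu : HasCompactSupport u) (hv : HasCompactSupport v) :
    HasCompactSupport fun z : EuclideanSpace ℝ ι =>
      u (coordProj P z) * v (coordProj (fun i => ¬ P i) z) := by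
  obtain ⟨r, hr⟩ := hu.isCompact.isBounded.exists_norm_le
  obtain ⟨s, hs⟩ := hv.isCompact.isBounded.exists_norm_le
  refine HasCompactSupport.of_support_subset_isCompact
    (isCompact_closedBall (0 : EuclideanSpace ℝ ι) (Real.sqrt (r ^ 2 + s ^ 2))) ?_
  intro z hz
  have h1 := hr _ (subset_closure (left_ne_zero_of_mul hz))
  have h2 := hs _ (subset_closure (right_ne_zero_of_mul hz))
  rw [mem_closedBall_zero_iff]
  apply Real.le_sqrt_of_sq_le
  rw [norm_sq_eq_add_coordProj P]
  gcongr

/-- The tensor product of two compactly supported Schwartz functions. -/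
def tensorSchwartz {u : 𝓢(EuclideanSpace ℝ {i // P i}, ℂ)}
    {v : 𝓢(EuclideanSpace ℝ {i // ¬ P i}, ℂ)} (hu : HasCompactSupport u)
    (hv : HasCompactSupport v) : 𝓢(EuclideanSpace ℝ ι, ℂ) :=
  (hasCompactSupport_coordProj_mul P hu hv).toSchwartzMap
    (((u.smooth ⊤).comp (coordProj P).contDiff).mul ((v.smooth ⊤).comp (coordProj fun i => ¬ P i).contDiff))

variable {P} {u : 𝓢(EuclideanSpace ℝ {i // P i}, ℂ)} {v : 𝓢(EuclideanSpace ℝ {i // ¬ P i}, ℂ)}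

theorem tensorSchwartz_apply (hu : HasCompactSupport u) (hv : HasCompactSupport v)
    (z : EuclideanSpace ℝ ι) : tensorSchwartz P hu hv z =
      u (coordProj P z) * v (coordProj (fun i => ¬ P i) z) := rfl

theorem fourierInv_tensorSchwartz (hu : HasCompactSupport u) (hv : HasCompactSupport v)
    (z : EuclideanSpace ℝ ι) : 𝓕⁻ (tensorSchwartz P hu hv) z =
      𝓕⁻ u (coordProj P z) * 𝓕⁻ v (coordProj (fun i => ¬ P i) z) := by
  simp only [SchwartzMap.fourierInv_coe, Real.fourierInv_eq]
  rw [← integral_coordProj_mul]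
  refine integral_congr_ae (Filter.Eventually.of_forall fun w => ?_)
  simp only [tensorSchwartz_apply]
  rw [inner_eq_add_coordProj P, AddChar.map_add_eq_mul]
  simp only [Circle.smul_def, Circle.coe_mul, smul_eq_mul]
  ring

theorem eLpNorm_fourierInv_tensorSchwartz (hu : HasCompactSupport u) (hv : HasCompactSupport v)
    {p : ℝ≥0∞} (hp0 : p ≠ 0) (hp : p ≠ ⊤) :
    eLpNorm (𝓕⁻ (tensorSchwartz P hu hv) : 𝓢(EuclideanSpace ℝ ι, ℂ)) p volume =
      eLpNorm (𝓕⁻ u : 𝓢(EuclideanSpace ℝ {i // P i}, ℂ)) p volume *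
      eLpNorm (𝓕⁻ v : 𝓢(EuclideanSpace ℝ {i // ¬ P i}, ℂ)) p volume := by
  simp only [eLpNorm_eq_lintegral_rpow_enorm_toReal hp0 hp]
  rw [← ENNReal.mul_rpow_of_nonneg _ _ (by positivity), ← lintegral_coordProj_mul P
    (((SchwartzMap.continuous _).enorm.measurable).pow_const _)
    (((SchwartzMap.continuous _).enorm.measurable).pow_const _)]
  simp_rw [fourierInv_tensorSchwartz, enorm_mul, ENNReal.mul_rpow_of_nonneg _ _
    ENNReal.toReal_nonneg]

end CoordinateSplitting

/-! ### Bumps on small balls and their scaling -/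

noncomputable section BallBumps

open scoped FourierTransform ContDiff LineDeriv

variable (E : Type*) [NormedAddCommGroup E] [InnerProductSpace ℝ E] [FiniteDimensional ℝ E]

theorem hasCompactSupport_ball {δ : ℝ} (hδ : 0 < δ) :
    HasCompactSupport fun ζ : E => ((unitBump (‖(2 * Real.pi / δ) • ζ‖ ^ 2) : ℝ) : ℂ) := by
  have hpi := Real.pi_pos
  refine HasCompactSupport.of_support_subset_isCompact (isCompact_closedBall (0 : E) (2 * δ)) ?_
  intro ζ hζ
  by_contra hn
  apply hζ
  have hn' : 2 * δ < ‖ζ‖ := by simpa using hn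
  have h1 : 2 ≤ ‖(2 * Real.pi / δ) • ζ‖ := by
    rw [norm_smul, Real.norm_of_nonneg (by positivity), div_mul_eq_mul_div, le_div_iff₀ hδ]
    nlinarith [Real.pi_gt_three]
  simp only [Complex.ofReal_eq_zero]
  apply unitBump_eq_zero
  rw [abs_of_nonneg (by positivity)]
  nlinarith

/-- A smooth bump adapted to the ball of radius `δ / (2 * π)`. -/
def ballBump {δ : ℝ} (hδ : 0 < δ) : 𝓢(E, ℂ) :=
  (hasCompactSupport_ball E hδ).toSchwartzMap (Complex.ofRealCLM.contDiff.comp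
    (unitBump.contDiff.comp ((contDiff_norm_sq ℝ).comp (contDiff_const_smul _))))

variable {E}

theorem ballBump_apply {δ : ℝ} (hδ : 0 < δ) (ζ : E) :
    ballBump E hδ ζ = ((unitBump (‖(2 * Real.pi / δ) • ζ‖ ^ 2) : ℝ) : ℂ) := rfl

theorem hasCompactSupport_ballBump {δ : ℝ} (hδ : 0 < δ) : HasCompactSupport (ballBump E hδ) :=
  hasCompactSupport_ball E hδ

variable [MeasurableSpace E] [BorelSpace E]

theorem fourierInv_ballBump {δ : ℝ} (hδ : 0 < δ) (x : E) :
    𝓕⁻ (ballBump E hδ) x =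
      (δ : ℂ) ^ Module.finrank ℝ E * 𝓕⁻ (ballBump E one_pos) (δ • x) := by
  simp only [SchwartzMap.fourierInv_coe, Real.fourierInv_eq]
  have h := Measure.integral_comp_inv_smul_of_nonneg (volume : Measure E)
    (fun v => 𝐞 (inner ℝ v (δ • x)) • ballBump E one_pos v) hδ.le
  rw [Complex.real_smul] at h
  push_cast at h
  rw [← h]
  refine integral_congr_ae (Filter.Eventually.of_forall fun v => ?_)
  simp only [ballBump_apply, inner_smul_left, inner_smul_right, smul_smul, div_one]
  simp only [conj_trivial, mul_inv_cancel_left₀ hδ.ne', div_eq_mul_inv]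

/-- The inverse transform is a dilate: its height contributes δ^n and the change of variables
δ^(-na). -/
theorem eLpNorm_fourierInv_ballBump {δ : ℝ} (hδ : 0 < δ) {p : ℝ≥0∞} {a : ℝ}
    (hpa : (1 / p).toReal = a) (ha : 0 < a) :
    eLpNorm (𝓕⁻ (ballBump E hδ) : 𝓢(E, ℂ)) p volume =
      ENNReal.ofReal (δ ^ (Module.finrank ℝ E * (1 - a))) *
        eLpNorm (𝓕⁻ (ballBump E one_pos) : 𝓢(E, ℂ)) p volume := by
  have hptop : p ≠ ⊤ := by rintro rfl; simp at hpa; linarith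
  have hp0 : p ≠ 0 := by rintro rfl; simp at hpa; linarith
  have hr : p.toReal = 1 / a := by
    rw [← hpa, ENNReal.toReal_div, ENNReal.toReal_one, one_div_one_div]
  set n := Module.finrank ℝ E
  set φ : 𝓢(E, ℂ) := 𝓕⁻ (ballBump E one_pos)
  have hφ : Measurable fun x => ‖φ x‖ₑ ^ (1 / a) := φ.continuous.enorm.measurable.pow_const _
  rw [eLpNorm_eq_lintegral_rpow_enorm_toReal hp0 hptop,
    eLpNorm_eq_lintegral_rpow_enorm_toReal hp0 hptop, hr, one_div_one_div]
  have hs : ∫⁻ x, ‖φ (δ • x)‖ₑ ^ (1 / a) =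
      ENNReal.ofReal ((δ ^ n)⁻¹) * ∫⁻ x, ‖φ x‖ₑ ^ (1 / a) := by
    rw [← lintegral_map (f := fun x => ‖φ x‖ₑ ^ (1 / a)) hφ (measurable_const_smul δ),
      Measure.map_addHaar_smul _ hδ.ne', lintegral_smul_measure, abs_of_nonneg (by positivity),
      smul_eq_mul]
  have hpt (x : E) : ‖(𝓕⁻ (ballBump E hδ) : 𝓢(E, ℂ)) x‖ₑ ^ (1 / a) =
      ENNReal.ofReal (δ ^ n) ^ (1 / a) * ‖φ (δ • x)‖ₑ ^ (1 / a) := by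
    rw [fourierInv_ballBump, enorm_mul, ENNReal.mul_rpow_of_nonneg _ _ (by positivity),
      ← ofReal_norm, norm_pow, Complex.norm_real, Real.norm_of_nonneg hδ.le]
  simp_rw [hpt]
  have hm : Measurable fun x => ‖φ (δ • x)‖ₑ ^ (1 / a) := hφ.comp (measurable_const_smul δ)
  rw [lintegral_const_mul _ hm, hs,
    ENNReal.mul_rpow_of_nonneg _ _ ha.le, ENNReal.mul_rpow_of_nonneg _ _ ha.le, ← mul_assoc,
    ← ENNReal.rpow_mul, one_div_mul_cancel ha.ne', ENNReal.rpow_one,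
    ENNReal.ofReal_rpow_of_nonneg (by positivity) ha.le, ← ENNReal.ofReal_mul (by positivity)]
  congr 2
  rw [← Real.rpow_natCast, ← Real.rpow_neg hδ.le, ← Real.rpow_mul hδ.le, ← Real.rpow_add hδ]
  congr 1; ring

end BallBumps

/-! ### Invariant test functions and neighbourhoods of great spheres -/

noncomputable section SymmetricTestFunctions

open scoped FourierTransform ContDiff LineDeriv Pointwise

theorem SchwartzMap.eLpNorm_volume_ne_top {E : Type*} [NormedAddCommGroup E]
    [InnerProductSpace ℝ E] [FiniteDimensional ℝ E] [MeasurableSpace E] [BorelSpace E]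
    (f : 𝓢(E, ℂ)) (p : ℝ≥0∞) : eLpNorm f p volume ≠ ⊤ :=
  (f.memLp p volume).eLpNorm_ne_top

theorem fourierHat_schwartz {d : ℕ} (f : 𝓢(EuclideanSpace ℝ (Fin d), ℂ))
    (ξ : EuclideanSpace ℝ (Fin d)) : fourierHat f ξ = 𝓕 f ((2 * Real.pi)⁻¹ • ξ) := by
  rw [SchwartzMap.fourier_coe, Real.fourier_eq]
  refine integral_congr_ae (Filter.Eventually.of_forall fun x => ?_)
  simp only [Circle.smul_def, Real.fourierChar_apply, smul_eq_mul, inner_smul_right,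
    real_inner_comm ξ x]
  rw [mul_comm]
  congr 2
  have hpi : (Real.pi : ℂ) ≠ 0 := by exact_mod_cast Real.pi_ne_zero
  push_cast
  field_simp

theorem fourierHat_fourierInv {d : ℕ} (g : 𝓢(EuclideanSpace ℝ (Fin d), ℂ))
    (ξ : EuclideanSpace ℝ (Fin d)) :
    fourierHat (𝓕⁻ g : 𝓢(EuclideanSpace ℝ (Fin d), ℂ)) ξ = g ((2 * Real.pi)⁻¹ • ξ) := by
  rw [fourierHat_schwartz, FourierTransform.fourier_fourierInv_eq]

/-- The action of an orthogonal matrix on `ℝ^ι`. -/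
abbrev orthogonalAction {ι : Type*} [Fintype ι] [DecidableEq ι] (A : Matrix.orthogonalGroup ι ℝ)
    (x : EuclideanSpace ℝ ι) : EuclideanSpace ℝ ι :=
  WithLp.toLp 2 (Matrix.mulVec (A : Matrix ι ι ℝ) (WithLp.ofLp x))

theorem norm_orthogonalAction {ι : Type*} [Fintype ι] [DecidableEq ι]
    (A : Matrix.orthogonalGroup ι ℝ) (x : EuclideanSpace ℝ ι) : ‖orthogonalAction A x‖ = ‖x‖ := by
  have h : ‖orthogonalAction A x‖ ^ 2 = ‖x‖ ^ 2 := by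
    rw [EuclideanSpace.real_norm_sq_eq, EuclideanSpace.real_norm_sq_eq]
    have h1 (v : ι → ℝ) : ∑ i, v i ^ 2 = dotProduct v v := by simp [dotProduct, sq]
    rw [h1, h1]
    change dotProduct (Matrix.mulVec (A : Matrix ι ι ℝ) x) (Matrix.mulVec (A : Matrix ι ι ℝ) x) = _
    rw [Matrix.dotProduct_mulVec, ← Matrix.mulVec_transpose, Matrix.mulVec_mulVec]
    have : (A : Matrix ι ι ℝ).transpose * (A : Matrix ι ι ℝ) = 1 :=
      (Matrix.mem_orthogonalGroup_iff' ι ℝ).1 A.2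
    rw [this, Matrix.one_mulVec]
  exact (sq_eq_sq₀ (norm_nonneg _) (norm_nonneg _)).1 h

/-- Replace x by y, with the coordinates outside the block set to zero. A block diagonal A keeps y
inside the block and acts on it as on the block part of x, so the isometry property of A restricts
to the block. -/
theorem norm_coordProj_orthogonalAction {ι : Type*} [Fintype ι] [DecidableEq ι]
    (P : ι → Prop) [DecidablePred P] (A : Matrix.orthogonalGroup ι ℝ)
    (hA : ∀ i j, ¬ (P i ↔ P j) → (A : Matrix ι ι ℝ) i j = 0) (x : EuclideanSpace ℝ ι) :
    ‖coordProj P (orthogonalAction A x)‖ = ‖coordProj P x‖ := by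
  set y : EuclideanSpace ℝ ι := WithLp.toLp 2 fun i => if P i then x i else 0
  have hy1 : coordProj P y = coordProj P x := by
    ext i
    simp [coordProj_apply, y, i.2]
  have hy2 : coordProj (fun i => ¬ P i) y = 0 := by
    ext i
    simp [coordProj_apply, y, i.2]
  have hy3 : coordProj P (orthogonalAction A y) = coordProj P (orthogonalAction A x) := by
    ext i
    simp only [coordProj_apply, orthogonalAction, Matrix.mulVec, dotProduct]
    refine Finset.sum_congr rfl fun j _ => ?_
    by_cases hj : P j
    · simp [y, hj]
    · rw [hA i j (fun h => hj (h.1 i.2)), zero_mul, zero_mul]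
  have hy4 : coordProj (fun i => ¬ P i) (orthogonalAction A y) = 0 := by
    ext i
    simp only [coordProj_apply, orthogonalAction, Matrix.mulVec, dotProduct]
    refine Finset.sum_eq_zero fun j _ => ?_
    by_cases hj : P j
    · rw [hA i j (fun h => i.2 (h.2 hj)), zero_mul]
    · simp [y, hj]
  have h1 := norm_sq_eq_add_coordProj P y
  have h2 := norm_sq_eq_add_coordProj P (orthogonalAction A y)
  rw [hy1, hy2] at h1
  rw [hy3, hy4, norm_orthogonalAction, h1] at h2
  simp only [norm_zero] at h2
  exact (sq_eq_sq₀ (norm_nonneg _) (norm_nonneg _)).1 (by linarith)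

/-- The inverse Fourier transform commutes with linear isometries. -/
theorem isGroupSymmetric_fourierInv {d : ℕ} {G : Subgroup (Matrix.orthogonalGroup (Fin d) ℝ)}
    (g : 𝓢(EuclideanSpace ℝ (Fin d), ℂ)) (hg : ∀ A ∈ G, ∀ x, g (orthogonalAction A x) = g x) :
    IsGroupSymmetric G (𝓕⁻ g : 𝓢(EuclideanSpace ℝ (Fin d), ℂ)) := by
  intro A hA x
  set T : EuclideanSpace ℝ (Fin d) →ₗᵢ[ℝ] EuclideanSpace ℝ (Fin d) :=
    { toLinearMap := Matrix.toEuclideanLin (A : Matrix (Fin d) (Fin d) ℝ)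
      norm_map' := fun z => norm_orthogonalAction A z }
  have h := Real.fourierInv_comp_linearIsometry (T.toLinearIsometryEquiv rfl) (⇑g) x
  have hgT : ⇑g ∘ (T.toLinearIsometryEquiv rfl) = ⇑g := funext fun z => hg A hA z
  rw [hgT] at h
  rw [SchwartzMap.fourierInv_coe]
  exact h.symm

/-- A lower bound for the Fourier transform on a part of the sphere, as a consequence of the
restriction estimate. -/
theorem SymmetricRestrictionEstimate.exists_le {d k : ℕ} {p q : ℝ≥0∞} (hq : 1 ≤ q)
    (h : SymmetricRestrictionEstimate d k p q) : ∃ C : ℝ≥0, ∀ g : 𝓢(EuclideanSpace ℝ (Fin d), ℂ),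
      (∀ A ∈ blockOrthogonalGroup d k, ∀ x, g (orthogonalAction A x) = g x) →
      ∀ (S : Set (Metric.sphere (0 : EuclideanSpace ℝ (Fin d)) 1)) (A : ℝ), MeasurableSet S →
        surfaceMeasure d S ≠ 0 → 0 ≤ A →
        (∀ θ ∈ S, A ≤ ‖g ((2 * Real.pi)⁻¹ • (θ : EuclideanSpace ℝ (Fin d)))‖) →
        ENNReal.ofReal A * surfaceMeasure d S ^ (1 / q).toReal ≤
          C * eLpNorm (𝓕⁻ g : 𝓢(EuclideanSpace ℝ (Fin d), ℂ)) p volume := by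
  obtain ⟨C, hC⟩ := h
  refine ⟨C, fun g hg S A hS hS0 hA0 hA => le_trans ?_ (hC _ (isGroupSymmetric_fourierInv g hg))⟩
  have h1 := eLpNorm_indicator_const' (c := A) (p := q) hS hS0 (zero_lt_one.trans_le hq).ne'
  rw [ENNReal.toReal_div, ENNReal.toReal_one, ← Real.enorm_of_nonneg hA0, ← h1]
  refine eLpNorm_mono fun θ => ?_
  rw [fourierHat_fourierInv]
  by_cases hθ : θ ∈ S
  · rw [Set.indicator_of_mem hθ, Real.norm_of_nonneg hA0]
    exact hA θ hθ
  · rw [Set.indicator_of_notMem hθ, norm_zero]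
    exact norm_nonneg _

/-- The neighbourhood of width `δ` of the great sphere in the coordinates that satisfy `P`. -/
def greatSphereNhd {ι : Type*} [Fintype ι] (P : ι → Prop) [DecidablePred P] (δ : ℝ) :
    Set (Metric.sphere (0 : EuclideanSpace ℝ ι) 1) :=
  {θ | ‖coordProj (fun i => ¬ P i) (θ : EuclideanSpace ℝ ι)‖ ≤ δ}

theorem measurableSet_greatSphereNhd {ι : Type*} [Fintype ι] (P : ι → Prop) [DecidablePred P]
    (δ : ℝ) : MeasurableSet (greatSphereNhd P δ) := by
  apply IsClosed.measurableSet
  exact isClosed_le (by fun_prop) continuous_const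

/-- The surface measure is d times the volume of the cone over the set. The cone contains the
product of the annulus 1/4 < ‖x‖ < 1/2 with a ball of radius δ/4: there 1/4 < ‖z‖ < 1, so
normalizing enlarges the second component to at most δ. -/
theorem exists_le_surfaceMeasure_greatSphereNhd {d : ℕ} (P : Fin d → Prop) [DecidablePred P]
    [Nonempty {i // P i}] : ∃ c : ℝ, 0 < c ∧ ∀ δ : ℝ, 0 < δ → δ ≤ 1 →
      ENNReal.ofReal (c * δ ^ Fintype.card {i // ¬ P i}) ≤
        surfaceMeasure d (greatSphereNhd P δ) := by
  set n := Fintype.card {i // ¬ P i}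
  set U : Set (EuclideanSpace ℝ {i // P i}) := {x | 1 / 4 < ‖x‖ ∧ ‖x‖ < 1 / 2}
  have hUo : IsOpen U := (isOpen_lt continuous_const continuous_norm).inter
    (isOpen_lt continuous_norm continuous_const)
  have hUne : U.Nonempty := by
    obtain ⟨x, hx⟩ := NormedSpace.exists_lt_norm ℝ (EuclideanSpace ℝ {i // P i}) 0
    refine ⟨(3 / 8 * ‖x‖⁻¹ : ℝ) • x, ?_⟩
    simp only [U, Set.mem_ofPred_eq, norm_smul, Real.norm_of_nonneg (by positivity :
      0 ≤ 3 / 8 * ‖x‖⁻¹), mul_assoc, inv_mul_cancel₀ hx.ne']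
    norm_num
  have hU0 : volume U ≠ 0 := (hUo.measure_pos volume hUne).ne'
  have hUt : volume U ≠ ⊤ := by
    refine ((measure_mono fun x hx => ?_).trans_lt
      (measure_ball_lt_top (x := (0 : EuclideanSpace ℝ {i // P i})) (r := 1 / 2))).ne
    simpa using hx.2
  set B := volume (Metric.ball (0 : EuclideanSpace ℝ {i // ¬ P i}) 1)
  have hB0 : B ≠ 0 := (Metric.measure_ball_pos volume _ one_pos).ne'
  have hBt : B ≠ ⊤ := measure_ball_lt_top.ne
  refine ⟨(volume U).toReal * ((1 / 4) ^ n * B.toReal), ?_, fun δ hδ hδ1 => ?_⟩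
  · have := ENNReal.toReal_pos hU0 hUt
    have := ENNReal.toReal_pos hB0 hBt
    positivity
  set V : Set (EuclideanSpace ℝ {i // ¬ P i}) := Metric.ball 0 (1 / 4 * δ)
  have hV : volume V = ENNReal.ofReal ((1 / 4 * δ) ^ n) * B := by
    simp only [V]
    rw [Measure.addHaar_ball_of_pos _ _ (by positivity), finrank_euclideanSpace]
  have hd : 0 < d := by
    obtain ⟨i⟩ := ‹Nonempty {i // P i}›
    exact i.1.pos
  have hsub : coordSplit P ⁻¹' (U ×ˢ V) ⊆
      Set.Ioo (0 : ℝ) 1 • ((↑) '' greatSphereNhd P δ : Set (EuclideanSpace ℝ (Fin d))) := by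
    intro z hz
    rw [Set.mem_preimage, coordSplit_apply] at hz
    obtain ⟨⟨hz1, hz2⟩, hz3⟩ := hz
    simp only [V, mem_ball_zero_iff] at hz1 hz2 hz3
    have hsq := norm_sq_eq_add_coordProj P z
    set s := ‖coordProj P z‖
    set t := ‖coordProj (fun i => ¬ P i) z‖
    have ht : 0 ≤ t := norm_nonneg _
    have k1 : 1 / 4 < ‖z‖ := by
      by_contra! hcon
      nlinarith [norm_nonneg z]
    have k2 : ‖z‖ < 1 := by
      by_contra! hcon
      nlinarith [norm_nonneg z]
    have hz0 : 0 < ‖z‖ := by linarith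
    refine ⟨‖z‖, ⟨hz0, k2⟩, ‖z‖⁻¹ • z, ⟨⟨‖z‖⁻¹ • z, ?_⟩, ?_, rfl⟩, ?_⟩
    · rw [mem_sphere_zero_iff_norm, norm_smul, norm_inv, norm_norm, inv_mul_cancel₀ hz0.ne']
    · change ‖coordProj (fun i => ¬ P i) (‖z‖⁻¹ • z)‖ ≤ δ
      rw [map_smul, norm_smul, norm_inv, norm_norm, inv_mul_le_iff₀ hz0]
      change t ≤ _
      nlinarith
    · change ‖z‖ • ‖z‖⁻¹ • z = z
      rw [smul_smul, mul_inv_cancel₀ hz0.ne', one_smul]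
  rw [surfaceMeasure, Measure.toSphere_apply' _ (measurableSet_greatSphereNhd P δ),
    finrank_euclideanSpace_fin]
  calc ENNReal.ofReal ((volume U).toReal * ((1 / 4) ^ n * B.toReal) * δ ^ n)
      = volume U * (ENNReal.ofReal ((1 / 4 * δ) ^ n) * B) := by
        conv_rhs => rw [← ENNReal.ofReal_toReal hUt, ← ENNReal.ofReal_toReal hBt]
        rw [← ENNReal.ofReal_mul (by positivity), ← ENNReal.ofReal_mul (by positivity)]
        congr 1; rw [mul_pow]; ring
    _ = volume (coordSplit P ⁻¹' (U ×ˢ V)) := by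
        rw [(measurePreserving_coordSplit P).measure_preimage
          (hUo.measurableSet.prod measurableSet_ball).nullMeasurableSet, Measure.volume_eq_prod,
          Measure.prod_prod, hV]
    _ ≤ volume (Set.Ioo (0 : ℝ) 1 • ((↑) '' greatSphereNhd P δ : Set (EuclideanSpace ℝ (Fin d)))) :=
        measure_mono hsub
    _ ≤ _ := le_mul_of_one_le_left zero_le (by exact_mod_cast Nat.succ_le_of_lt hd)

theorem tensorSchwartz_ballBump_orthogonalAction {ι : Type*} [Fintype ι] [DecidableEq ι]
    {P : ι → Prop} [DecidablePred P] {u : 𝓢(EuclideanSpace ℝ {i // P i}, ℂ)}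
    (hu : HasCompactSupport u) (hur : ∀ x y, ‖x‖ = ‖y‖ → u x = u y) {δ : ℝ} (hδ : 0 < δ)
    (A : Matrix.orthogonalGroup ι ℝ)
    (hA : ∀ i j, ¬ (P i ↔ P j) → (A : Matrix ι ι ℝ) i j = 0) (x : EuclideanSpace ℝ ι) :
    tensorSchwartz P hu (hasCompactSupport_ballBump hδ) (orthogonalAction A x) =
      tensorSchwartz P hu (hasCompactSupport_ballBump hδ) x := by
  rw [tensorSchwartz_apply, tensorSchwartz_apply,
    hur _ _ (norm_coordProj_orthogonalAction P A hA x), ballBump_apply, ballBump_apply, norm_smul,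
    norm_smul, norm_coordProj_orthogonalAction _ A
      (fun i j hij => hA i j fun h' => hij (not_congr h')) x]

/-- Curvature enters here: on the unit sphere the squared block component is 1 minus the squared
transversal one, so a transversal size δ costs only δ². The ball factor equals 1 at such points. -/
theorem le_norm_tensorSchwartz_ballBump {ι : Type*} [Fintype ι] {P : ι → Prop} [DecidablePred P]
    {u : 𝓢(EuclideanSpace ℝ {i // P i}, ℂ)} (hu : HasCompactSupport u) {δ A : ℝ} (hδ : 0 < δ)
    (hA : ∀ ζ, |4 * Real.pi ^ 2 * ‖ζ‖ ^ 2 - 1| ≤ δ ^ 2 → A ≤ ‖u ζ‖)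
    {x : EuclideanSpace ℝ ι} (hx1 : ‖x‖ = 1) (hx2 : ‖coordProj (fun i => ¬ P i) x‖ ≤ δ) :
    A ≤ ‖tensorSchwartz P hu (hasCompactSupport_ballBump hδ) ((2 * Real.pi)⁻¹ • x)‖ := by
  have hsq := norm_sq_eq_add_coordProj P x
  have hpi := Real.pi_pos
  rw [hx1] at hsq
  have hone : ballBump (EuclideanSpace ℝ {i // ¬ P i}) hδ (coordProj (fun i => ¬ P i)
      ((2 * Real.pi)⁻¹ • x)) = 1 := by
    rw [ballBump_apply, map_smul, smul_smul, unitBump_eq_one, Complex.ofReal_one]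
    rw [abs_of_nonneg (by positivity), norm_smul, Real.norm_of_nonneg (by positivity)]
    have : 2 * Real.pi / δ * (2 * Real.pi)⁻¹ = δ⁻¹ := by field_simp
    rw [this, ← div_eq_inv_mul]
    exact pow_le_one₀ (by positivity) ((div_le_one hδ).2 hx2)
  rw [tensorSchwartz_apply, hone, mul_one]
  apply hA
  rw [map_smul, norm_smul, Real.norm_of_nonneg (by positivity)]
  have : 4 * Real.pi ^ 2 * ((2 * Real.pi)⁻¹ * ‖coordProj P x‖) ^ 2 - 1
      = -‖coordProj (fun i => ¬ P i) x‖ ^ 2 := by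
    rw [mul_pow, inv_pow]
    have : 4 * Real.pi ^ 2 * (((2 * Real.pi) ^ 2)⁻¹ * ‖coordProj P x‖ ^ 2) =
        ‖coordProj P x‖ ^ 2 := by field_simp; norm_num
    linarith
  rw [this, abs_neg, abs_of_nonneg (by positivity)]
  gcongr

/-- Exponent bookkeeping: the measure of the neighbourhood gives δ^(nb) on the left, the ball bump
gives δ^(n(1-a)) on the right, and the quotient is δ^(n(a+b-1)). -/
theorem ofReal_rpow_le_of_scaled_le {A δ a b c C N : ℝ} {n : ℕ} {M : ℝ≥0∞} (hMt : M ≠ ⊤)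
    (hA0 : 0 ≤ A) (hδ : 0 < δ) (hb : 0 ≤ b) (hc0 : 0 < c) (hC : 0 ≤ C) (hN : 0 ≤ N)
    (h : ENNReal.ofReal A * ENNReal.ofReal (c * δ ^ n) ^ b ≤ ENNReal.ofReal C *
      (M * (ENNReal.ofReal (δ ^ (n * (1 - a))) * ENNReal.ofReal N))) :
    ENNReal.ofReal (A * δ ^ (n * (a + b - 1))) ≤ ENNReal.ofReal ((C * N + 1) / c ^ b) * M := by
  rw [← ENNReal.ofReal_toReal hMt] at h ⊢
  rw [ENNReal.ofReal_rpow_of_nonneg (by positivity) hb, ← ENNReal.ofReal_mul hA0,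
    ← ENNReal.ofReal_mul (by positivity), ← ENNReal.ofReal_mul (by positivity),
    ← ENNReal.ofReal_mul (by positivity), ENNReal.ofReal_le_ofReal_iff (by positivity),
    Real.mul_rpow hc0.le (by positivity)] at h
  rw [← ENNReal.ofReal_mul (by positivity)]
  apply ENNReal.ofReal_le_ofReal
  have e1 : δ ^ (n * (a + b - 1)) = (δ ^ n) ^ b / δ ^ (n * (1 - a)) := by
    rw [← Real.rpow_natCast, ← Real.rpow_mul hδ.le, ← Real.rpow_sub hδ]
    congr 1; ring
  rw [e1, mul_div_assoc', div_le_iff₀ (by positivity), div_mul_eq_mul_div, div_mul_eq_mul_div,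
    le_div_iff₀ (by positivity)]
  calc _ = A * (c ^ b * (δ ^ n) ^ b) := by ring
    _ ≤ _ := h
    _ = (C * N) * M.toReal * δ ^ (n * (1 - a)) := by ring
    _ ≤ _ := by gcongr; linarith

/-- The consequence of the restriction estimate for functions whose Fourier transform lives near a
great sphere. -/
theorem SymmetricRestrictionEstimate.exists_le_tensor {d k : ℕ} {p q : ℝ≥0∞} {a b : ℝ}
    (hq : 1 ≤ q) (hpa : (1 / p).toReal = a) (hqb : (1 / q).toReal = b) (ha : 0 < a)
    (h : SymmetricRestrictionEstimate d k p q) (P : Fin d → Prop) [DecidablePred P]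
    [Nonempty {i // P i}]
    (hP : ∀ A ∈ blockOrthogonalGroup d k, ∀ i j, ¬ (P i ↔ P j) →
      (A : Matrix (Fin d) (Fin d) ℝ) i j = 0) :
    ∃ C : ℝ, 0 < C ∧ ∀ (u : 𝓢(EuclideanSpace ℝ {i // P i}, ℂ)) (δ A : ℝ), HasCompactSupport u →
      (∀ x y, ‖x‖ = ‖y‖ → u x = u y) → 0 < δ → δ ≤ 1 → 0 ≤ A →
      (∀ ζ, |4 * Real.pi ^ 2 * ‖ζ‖ ^ 2 - 1| ≤ δ ^ 2 → A ≤ ‖u ζ‖) →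
      ENNReal.ofReal (A * δ ^ (Fintype.card {i // ¬ P i} * (a + b - 1))) ≤
        ENNReal.ofReal C *
          eLpNorm (𝓕⁻ u : 𝓢(EuclideanSpace ℝ {i // P i}, ℂ)) p volume := by
  obtain ⟨C, hC⟩ := h.exists_le hq
  obtain ⟨c, hc0, hc⟩ := exists_le_surfaceMeasure_greatSphereNhd P
  have hptop : p ≠ ⊤ := by rintro rfl; simp at hpa; linarith
  have hp0 : p ≠ 0 := by rintro rfl; simp at hpa; linarith
  have hb : 0 ≤ b := by rw [← hqb]; exact ENNReal.toReal_nonneg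
  obtain ⟨N, hN⟩ : ∃ N : ℝ≥0∞, N = eLpNorm
    (𝓕⁻ (ballBump (EuclideanSpace ℝ {i // ¬ P i}) one_pos) :
      𝓢(EuclideanSpace ℝ {i // ¬ P i}, ℂ)) p volume := ⟨_, rfl⟩
  have hNt : N ≠ ⊤ := by rw [hN]; exact SchwartzMap.eLpNorm_volume_ne_top _ p
  refine ⟨(C * N.toReal + 1) / c ^ b, by positivity, fun u δ A hu hur hδ hδ1 hA0 hA => ?_⟩
  have hS := hc δ hδ hδ1
  have hS0 : surfaceMeasure d (greatSphereNhd P δ) ≠ 0 := by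
    refine (lt_of_lt_of_le ?_ hS).ne'
    rw [ENNReal.ofReal_pos]; positivity
  have key := hC (tensorSchwartz P hu (hasCompactSupport_ballBump hδ))
    (fun A hA x => tensorSchwartz_ballBump_orthogonalAction hu hur hδ A (hP A hA) x)
    (greatSphereNhd P δ) A (measurableSet_greatSphereNhd P δ) hS0 hA0
    (fun θ hθ => le_norm_tensorSchwartz_ballBump hu hδ hA (mem_sphere_zero_iff_norm.1 θ.2) hθ)
  rw [hqb, eLpNorm_fourierInv_tensorSchwartz hu _ hp0 hptop,
    eLpNorm_fourierInv_ballBump hδ hpa ha, finrank_euclideanSpace, ← hN] at key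
  refine ofReal_rpow_le_of_scaled_le (SchwartzMap.eLpNorm_volume_ne_top _ p) hA0 hδ hb hc0 C.2
    ENNReal.toReal_nonneg ?_
  rw [ENNReal.ofReal_toReal hNt]
  refine le_trans ?_ (key.trans (le_of_eq ?_))
  · gcongr
  · rw [← ENNReal.ofReal_coe_nnreal]

end SymmetricTestFunctions

/-! ### Derivation of the necessary conditions -/

noncomputable section NecessaryConditions

open scoped FourierTransform

theorem nonneg_of_forall_le_mul_rpow {c C e : ℝ} (hc : 0 < c)
    (h : ∀ R : ℝ, 4 ≤ R → c ≤ C * R ^ e) : 0 ≤ e := by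
  by_contra! he
  have h1 : Filter.Tendsto (fun R : ℝ => C * R ^ (-(-e))) Filter.atTop (nhds (C * 0)) :=
    (tendsto_rpow_neg_atTop (by linarith : 0 < -e)).const_mul C
  rw [neg_neg, mul_zero] at h1
  have h2 := ge_of_tendsto h1 (b := c)
    (by filter_upwards [Filter.eventually_ge_atTop 4] with R hR using h R hR)
  linarith

theorem not_forall_natCast_le_mul_rpow {C a : ℝ} (ha : a < 1) :
    ¬ ∀ J : ℕ, 1 ≤ J → (J : ℝ) ≤ C * (J : ℝ) ^ a := by
  intro h
  have h1 : Filter.Tendsto (fun J : ℕ => C * (J : ℝ) ^ (-(1 - a))) Filter.atTop (nhds (C * 0)) :=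
    ((tendsto_rpow_neg_atTop (by linarith : 0 < 1 - a)).comp
      tendsto_natCast_atTop_atTop).const_mul C
  rw [mul_zero] at h1
  have h2 := ge_of_tendsto h1 (b := 1) (by
    filter_upwards [Filter.eventually_ge_atTop 1] with J hJ
    have hJ0 : (0 : ℝ) < J := by exact_mod_cast hJ
    rw [neg_sub, Real.rpow_sub hJ0, Real.rpow_one, mul_div_assoc', le_div_iff₀ hJ0, one_mul]
    exact h J hJ)
  linarith

section

variable {E : Type*} [NormedAddCommGroup E] [InnerProductSpace ℝ E] [FiniteDimensional ℝ E]

theorem shellBump_eq_of_norm_eq {R : ℝ} (hR : 0 < R) {x y : E} (h : ‖x‖ = ‖y‖) :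
    shellBump E hR x = shellBump E hR y := by
  rw [shellBump_apply, shellBump_apply, h]

theorem shellBump_eq_one {R ε : ℝ} (hR : 0 < R) {x : E}
    (hx : |4 * Real.pi ^ 2 * ‖x‖ ^ 2 - 1| ≤ ε) (hε : R * ε ≤ 1) : shellBump E hR x = 1 := by
  rw [shellBump_apply, unitBump_eq_one, Complex.ofReal_one]
  rw [abs_mul, abs_of_pos hR]
  exact (mul_le_mul_of_nonneg_left hx hR.le).trans hε

theorem logBump_apply (J : ℕ) (x : E) : logBump E J x =
    ∑ i ∈ Finset.range J, shellBump E (by positivity : (0 : ℝ) < 4 ^ (i + 1)) x := by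
  rw [logBump, sum_apply]

theorem logBump_eq_of_norm_eq (J : ℕ) {x y : E} (h : ‖x‖ = ‖y‖) :
    logBump E J x = logBump E J y := by
  simp_rw [logBump_apply, shellBump_eq_of_norm_eq _ h]

theorem hasCompactSupport_logBump (J : ℕ) : HasCompactSupport (logBump E J) := by
  induction J with
  | zero =>
    have : ⇑(logBump E 0) = 0 := by
      ext x; simp [logBump]
    rw [this]
    exact HasCompactSupport.zero
  | succ J ih =>
    have : ⇑(logBump E (J + 1)) = ⇑(logBump E J) +
        ⇑(shellBump E (by positivity : (0 : ℝ) < 4 ^ (J + 1))) := by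
      ext x
      rw [Pi.add_apply, logBump_apply, logBump_apply, Finset.sum_range_succ]
    rw [this]
    exact ih.add (hasCompactSupport_shellBump _)

theorem logBump_eq_natCast {J : ℕ} {x : E}
    (hx : |4 * Real.pi ^ 2 * ‖x‖ ^ 2 - 1| ≤ ((1 / 2) ^ J) ^ 2) : logBump E J x = J := by
  rw [logBump_apply, Finset.sum_congr rfl fun i hi => shellBump_eq_one _ hx ?_]
  · simp
  · have h1 : (4 : ℝ) ^ (i + 1) ≤ 4 ^ J :=
      pow_le_pow_right₀ (by norm_num) (Finset.mem_range.1 hi)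
    calc (4 : ℝ) ^ (i + 1) * ((1 / 2) ^ J) ^ 2 ≤ 4 ^ J * ((1 / 2) ^ J) ^ 2 := by gcongr
      _ = 1 := by
        rw [← pow_mul, mul_comm J 2, pow_mul, ← mul_pow]; norm_num

variable [MeasurableSpace E] [BorelSpace E]

/-- For p ≥ 2 no weight is needed: interpolate between the squared L² norm and the L^∞ norm, both at
most C/R. -/
theorem exists_eLpNorm_fourierInv_shellBump_le_of_two_le [Nontrivial E] {p : ℝ≥0∞} {a : ℝ}
    (hp : p ≠ 0) (hpa : (1 / p).toReal = a) (ha : a ≤ 1 / 2) :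
    ∃ C : ℝ, 0 < C ∧ ∀ (R : ℝ) (hR : 4 ≤ R),
      eLpNorm (𝓕⁻ (shellBump E (by linarith : 0 < R)) : 𝓢(E, ℂ)) p volume ≤
        ENNReal.ofReal (C * R ^ (-(1 - a))) := by
  obtain ⟨C, hC0, hC⟩ := exists_fourierInv_shellBump_bounds (E := E)
  refine ⟨C ^ (1 - a), by positivity, fun R hR => ?_⟩
  have hR0 : 0 < R := by linarith
  obtain ⟨b1, -, b3⟩ := hC R hR
  set f : 𝓢(E, ℂ) := 𝓕⁻ (shellBump E hR0)
  have e : C ^ (1 - a) * R ^ (-(1 - a)) = (C / R) ^ (1 - a) := by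
    rw [Real.div_rpow hC0.le hR0.le, Real.rpow_neg hR0.le, div_eq_mul_inv]
  rw [e]
  have hCR : 0 < C / R := by positivity
  have hb (x : E) : ‖f x‖ₑ ≤ ENNReal.ofReal (C / R) := by
    rw [← ofReal_norm]; exact ENNReal.ofReal_le_ofReal (b3 x)
  by_cases hptop : p = ⊤
  · have : a = 0 := by rw [← hpa, hptop]; simp
    rw [this, sub_zero, Real.rpow_one, hptop, eLpNorm_exponent_top]
    exact eLpNormEssSup_le_of_ae_enorm_bound (Filter.Eventually.of_forall hb)
  · have ha0 : 0 < a := by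
      rw [← hpa, ENNReal.toReal_div, ENNReal.toReal_one]
      exact one_div_pos.2 (ENNReal.toReal_pos hp hptop)
    have hr : p.toReal = 1 / a := by
      rw [← hpa, ENNReal.toReal_div, ENNReal.toReal_one, one_div_one_div]
    have hr2 : 0 ≤ 1 / a - 2 := by
      rw [sub_nonneg, le_div_iff₀ ha0]; linarith
    rw [eLpNorm_eq_lintegral_rpow_enorm_toReal hp hptop, hr, one_div_one_div]
    have hpt (x : E) : ‖f x‖ₑ ^ (1 / a) ≤
        ENNReal.ofReal (C / R) ^ (1 / a - 2) * ENNReal.ofReal (‖f x‖ ^ 2) := by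
      have : ENNReal.ofReal (‖f x‖ ^ 2) = ‖f x‖ₑ ^ (2 : ℝ) := by
        rw [ENNReal.ofReal_pow (norm_nonneg _), ofReal_norm, ENNReal.rpow_two]
      rw [this]
      calc ‖f x‖ₑ ^ (1 / a) = ‖f x‖ₑ ^ (1 / a - 2) * ‖f x‖ₑ ^ (2 : ℝ) := by
            rw [← ENNReal.rpow_add_of_nonneg _ _ hr2 (by norm_num), sub_add_cancel]
        _ ≤ _ := by gcongr; exact hb x
    calc (∫⁻ x, ‖f x‖ₑ ^ (1 / a)) ^ a
        ≤ (∫⁻ x, ENNReal.ofReal (C / R) ^ (1 / a - 2) * ENNReal.ofReal (‖f x‖ ^ 2)) ^ a := by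
          gcongr with x; exact hpt x
      _ = (ENNReal.ofReal ((C / R) ^ (1 / a - 2)) * ENNReal.ofReal (∫ x, ‖f x‖ ^ 2)) ^ a := by
          rw [lintegral_const_mul _ (by fun_prop), ENNReal.ofReal_rpow_of_pos hCR,
            ofReal_integral_eq_lintegral_ofReal f.integrable_norm_sq
              (Filter.Eventually.of_forall fun x => by positivity)]
      _ ≤ (ENNReal.ofReal ((C / R) ^ (1 / a - 2)) * ENNReal.ofReal (C / R)) ^ a := by gcongr
      _ = _ := by
          rw [← ENNReal.ofReal_mul (by positivity), ENNReal.ofReal_rpow_of_pos (by positivity)]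
          congr 1
          have : (C / R) ^ (1 / a - 2) * (C / R) = (C / R) ^ (1 / a - 1) := by
            rw [← Real.rpow_add_one hCR.ne']; congr 1; ring
          rw [this, ← Real.rpow_mul hCR.le]
          congr 1; field_simp

end

/-- The consequence of the restriction estimate for radial functions. -/
theorem SymmetricRestrictionEstimate.exists_le_radial {d k : ℕ} {p q : ℝ≥0∞} (hd : 0 < d)
    (hq : 1 ≤ q) (h : SymmetricRestrictionEstimate d k p q) :
    ∃ C : ℝ, 0 < C ∧ ∀ (g : 𝓢(EuclideanSpace ℝ (Fin d), ℂ)) (A : ℝ),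
      (∀ x y, ‖x‖ = ‖y‖ → g x = g y) → 0 ≤ A →
      (∀ ζ, |4 * Real.pi ^ 2 * ‖ζ‖ ^ 2 - 1| ≤ 0 → A ≤ ‖g ζ‖) →
      ENNReal.ofReal A ≤ ENNReal.ofReal C *
        eLpNorm (𝓕⁻ g : 𝓢(EuclideanSpace ℝ (Fin d), ℂ)) p volume := by
  obtain ⟨C, hC⟩ := h.exists_le hq
  have : NeZero d := ⟨hd.ne'⟩
  set b := (1 / q).toReal
  have hb : 0 ≤ b := ENNReal.toReal_nonneg
  set s := surfaceMeasure d Set.univ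
  have hs0 : s ≠ 0 := Measure.measure_univ_ne_zero.2 (Measure.toSphere_ne_zero _)
  have hst : s ≠ ⊤ := by
    simp only [s, surfaceMeasure]; exact measure_ne_top _ _
  have hs : 0 < s.toReal := ENNReal.toReal_pos hs0 hst
  refine ⟨(C + 1) / s.toReal ^ b, by positivity, fun g A hg hA0 hA => ?_⟩
  have key := hC g (fun B _ x => hg _ _ (norm_orthogonalAction B x)) Set.univ A
    MeasurableSet.univ hs0 hA0 fun θ _ => hA _ ?_
  · have hMt := SchwartzMap.eLpNorm_volume_ne_top (𝓕⁻ g : 𝓢(EuclideanSpace ℝ (Fin d), ℂ)) p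
    rw [← ENNReal.ofReal_toReal hMt] at key ⊢
    change ENNReal.ofReal A * s ^ b ≤ _ at key
    rw [← ENNReal.ofReal_toReal hst, ENNReal.ofReal_rpow_of_pos hs, ← ENNReal.ofReal_mul hA0,
      ← ENNReal.ofReal_coe_nnreal, ← ENNReal.ofReal_mul (NNReal.coe_nonneg C),
      ENNReal.ofReal_le_ofReal_iff (by positivity)] at key
    rw [← ENNReal.ofReal_mul (by positivity)]
    apply ENNReal.ofReal_le_ofReal
    rw [div_mul_eq_mul_div, le_div_iff₀ (by positivity)]
    refine key.trans ?_
    gcongr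
    linarith
  · have hpi := Real.pi_pos
    have : 4 * Real.pi ^ 2 * ‖(2 * Real.pi)⁻¹ • (θ : EuclideanSpace ℝ (Fin d))‖ ^ 2 - 1 = 0 := by
      rw [norm_smul, Real.norm_of_nonneg (by positivity), mem_sphere_zero_iff_norm.1 θ.2]
      field_simp; norm_num
    rw [this, abs_zero]

/-- Radial functions see the whole sphere, so q plays no role. Below the threshold, shells of height
1 on the sphere have L^p norm tending to 0, by interpolation for a ≤ 1/2 and by the weighted bound
otherwise. At the threshold the dyadic sums would give J ≤ C J^a with a < 1. -/
theorem lt_of_symmetricRestrictionEstimate {d k : ℕ} {p q : ℝ≥0∞} {a : ℝ} (hd : 2 ≤ d)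
    (hp : 1 ≤ p) (hq : 1 ≤ q) (hpa : (1 / p).toReal = a)
    (h : SymmetricRestrictionEstimate d k p q) : ((d : ℝ) + 1) / (2 * d) < a := by
  obtain ⟨C, hC0, hC⟩ := h.exists_le_radial (by omega) hq
  have : NeZero d := ⟨by omega⟩
  have hd2 : (2 : ℝ) ≤ d := by exact_mod_cast hd
  have hshell {e D : ℝ} (he : e < 0) (hD : 0 < D) (hle : ∀ (R : ℝ) (hR : 4 ≤ R),
      eLpNorm (𝓕⁻ (shellBump (EuclideanSpace ℝ (Fin d)) (by linarith : 0 < R)) :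
        𝓢(EuclideanSpace ℝ (Fin d), ℂ)) p volume ≤ ENNReal.ofReal (D * R ^ e)) : False := by
    refine absurd (nonneg_of_forall_le_mul_rpow (c := 1) (C := C * D) one_pos fun R hR => ?_)
      he.not_ge
    have hR0 : 0 < R := by linarith
    have h1 := hC (shellBump _ hR0) 1 (fun _ _ => shellBump_eq_of_norm_eq hR0) zero_le_one
      fun ζ hζ => by rw [shellBump_eq_one hR0 hζ (by simp), norm_one]
    have h2 := h1.trans (mul_le_mul_right (hle R hR) _)
    rw [← ENNReal.ofReal_mul hC0.le, ENNReal.ofReal_le_ofReal_iff (by positivity)] at h2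
    linarith
  by_contra! hcon
  rcases le_or_gt a (1 / 2) with ha | ha
  · obtain ⟨D, hD0, hD⟩ := exists_eLpNorm_fourierInv_shellBump_le_of_two_le
      (E := EuclideanSpace ℝ (Fin d)) (zero_lt_one.trans_le hp).ne' hpa ha
    exact hshell (by linarith) hD0 hD
  rw [le_div_iff₀ (by positivity)] at hcon
  rcases hcon.lt_or_eq with hlt | heq
  · obtain ⟨D, hD0, hD⟩ := exists_eLpNorm_fourierInv_shellBump_le
      (E := EuclideanSpace ℝ (Fin d)) hpa ha (by rw [finrank_euclideanSpace_fin]; nlinarith)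
    refine hshell ?_ hD0 hD
    rw [finrank_euclideanSpace_fin]
    nlinarith
  · obtain ⟨D, hD0, hD⟩ := exists_eLpNorm_fourierInv_logBump_le
      (E := EuclideanSpace ℝ (Fin d)) hpa (by
        rw [finrank_euclideanSpace_fin, eq_div_iff (by positivity)]; exact heq)
    refine not_forall_natCast_le_mul_rpow (C := C * D) (a := a) (by nlinarith) fun J hJ => ?_
    have h1 := hC (logBump _ J) J (fun _ _ => logBump_eq_of_norm_eq J) (Nat.cast_nonneg J)
      fun ζ hζ => by
        rw [logBump_eq_natCast (hζ.trans (by positivity)), Complex.norm_natCast]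
    have h2 := h1.trans (mul_le_mul_right (hD J hJ) _)
    rw [← ENNReal.ofReal_mul hC0.le, ENNReal.ofReal_le_ofReal_iff (by positivity)] at h2
    linarith

section

variable {d k : ℕ} {p q : ℝ≥0∞} {a b : ℝ} {P : Fin d → Prop} [DecidablePred P]
  [Nonempty {i // P i}]

/-- The radial factor stays fixed at scale 4 and only δ = R^(-1/2) shrinks; its inverse transform
has a finite norm independent of δ, so δ^(n(a+b-1)) stays bounded. -/
theorem one_le_add_of_symmetricRestrictionEstimate [Nonempty {i // ¬ P i}]
    (hq : 1 ≤ q) (hpa : (1 / p).toReal = a) (hqb : (1 / q).toReal = b) (ha : 0 < a)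
    (h : SymmetricRestrictionEstimate d k p q)
    (hP : ∀ A ∈ blockOrthogonalGroup d k, ∀ i j, ¬ (P i ↔ P j) →
      (A : Matrix (Fin d) (Fin d) ℝ) i j = 0) : 1 ≤ a + b := by
  obtain ⟨C, hC0, hC⟩ := h.exists_le_tensor hq hpa hqb ha P hP
  set n := Fintype.card {i // ¬ P i}
  have hn : (0 : ℝ) < n := by
    have : 0 < n := Fintype.card_pos
    exact_mod_cast this
  set u := shellBump (EuclideanSpace ℝ {i // P i}) (by norm_num : (0 : ℝ) < 4)
  obtain ⟨M, hM⟩ : ∃ M, M = eLpNorm (𝓕⁻ u : 𝓢(EuclideanSpace ℝ {i // P i}, ℂ)) p volume :=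
    ⟨_, rfl⟩
  have hMt : M ≠ ⊤ := by rw [hM]; exact SchwartzMap.eLpNorm_volume_ne_top _ p
  have key : 0 ≤ n * (a + b - 1) * (1 / 2) := by
    refine nonneg_of_forall_le_mul_rpow (c := 1) (C := C * M.toReal) one_pos fun R hR => ?_
    have hR0 : 0 < R := by linarith
    have hδ2 : (R ^ (-(1 / 2) : ℝ)) ^ 2 = R⁻¹ := by
      rw [← Real.rpow_natCast, ← Real.rpow_mul hR0.le]
      norm_num [Real.rpow_neg_one]
    have h1 := hC u (R ^ (-(1 / 2) : ℝ)) 1 (hasCompactSupport_shellBump _)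
      (fun _ _ => shellBump_eq_of_norm_eq _) (by positivity)
      (Real.rpow_le_one_of_one_le_of_nonpos (by linarith) (by norm_num)) zero_le_one fun ζ hζ => by
        rw [hδ2] at hζ
        rw [shellBump_eq_one _ hζ (by rw [← div_eq_mul_inv, div_le_one hR0]; exact hR), norm_one]
    rw [← hM, ← ENNReal.ofReal_toReal hMt, ← ENNReal.ofReal_mul hC0.le,
      ENNReal.ofReal_le_ofReal_iff (by positivity), one_mul, ← Real.rpow_mul hR0.le] at h1
    have e : -(1 / 2) * (n * (a + b - 1)) = -(n * (a + b - 1) * (1 / 2)) := by ring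
    rw [e, Real.rpow_neg hR0.le] at h1
    have hpos := Real.rpow_pos_of_pos hR0 (n * (a + b - 1) * (1 / 2))
    calc 1 = (R ^ (n * (a + b - 1) * (1 / 2)))⁻¹ * R ^ (n * (a + b - 1) * (1 / 2)) :=
          (inv_mul_cancel₀ hpos.ne').symm
      _ ≤ _ := by gcongr
  nlinarith

/-- The choice δ = R^(-1/2) is the widest neighbourhood whose projection, deviating by δ², stays
where the shell bump at scale R is known to equal 1. Comparing powers of R gives the inequality. -/
theorem le_of_symmetricRestrictionEstimate_of_lt
    (hq : 1 ≤ q) (hpa : (1 / p).toReal = a) (hqb : (1 / q).toReal = b) (ha : 1 / 2 < a)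
    (ha' : Fintype.card {i // P i} * (2 * a - 1) < 2)
    (h : SymmetricRestrictionEstimate d k p q)
    (hP : ∀ A ∈ blockOrthogonalGroup d k, ∀ i j, ¬ (P i ↔ P j) →
      (A : Matrix (Fin d) (Fin d) ℝ) i j = 0) :
    1 ≤ Fintype.card {i // ¬ P i} * (a + b - 1) + Fintype.card {i // P i} * (2 * a - 1) := by
  obtain ⟨C, hC0, hC⟩ := h.exists_le_tensor hq hpa hqb (by linarith) P hP
  obtain ⟨D, hD0, hD⟩ := exists_eLpNorm_fourierInv_shellBump_le
      (E := EuclideanSpace ℝ {i // P i}) hpa ha (by rw [finrank_euclideanSpace]; exact ha')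
  rw [finrank_euclideanSpace] at hD
  set n := Fintype.card {i // ¬ P i}
  set m := Fintype.card {i // P i}
  have key : 0 ≤ n * (a + b - 1) * (1 / 2) + (m * (a - 1 / 2) - 1 / 2) := by
    refine nonneg_of_forall_le_mul_rpow (c := 1) (C := C * D) one_pos fun R hR => ?_
    have hR0 : 0 < R := by linarith
    have hδ2 : (R ^ (-(1 / 2) : ℝ)) ^ 2 = R⁻¹ := by
      rw [← Real.rpow_natCast, ← Real.rpow_mul hR0.le]
      norm_num [Real.rpow_neg_one]
    have h0 := hC (shellBump _ hR0) (R ^ (-(1 / 2) : ℝ)) 1 (hasCompactSupport_shellBump _)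
      (fun _ _ => shellBump_eq_of_norm_eq _) (by positivity)
      (Real.rpow_le_one_of_one_le_of_nonpos (by linarith) (by norm_num)) zero_le_one fun ζ hζ => by
        rw [hδ2] at hζ
        rw [shellBump_eq_one _ hζ (mul_inv_cancel₀ hR0.ne').le, norm_one]
    have h1 := h0.trans (mul_le_mul_right (hD R hR) _)
    rw [← ENNReal.ofReal_mul hC0.le,
      ENNReal.ofReal_le_ofReal_iff (by positivity), one_mul, ← Real.rpow_mul hR0.le] at h1
    have e : -(1 / 2) * (n * (a + b - 1)) = -(n * (a + b - 1) * (1 / 2)) := by ring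
    rw [e, Real.rpow_neg hR0.le] at h1
    have hpos := Real.rpow_pos_of_pos hR0 (n * (a + b - 1) * (1 / 2))
    rw [Real.rpow_add hR0]
    calc 1 = (R ^ (n * (a + b - 1) * (1 / 2)))⁻¹ * R ^ (n * (a + b - 1) * (1 / 2)) :=
          (inv_mul_cancel₀ hpos.ne').symm
      _ ≤ (C * (D * R ^ (m * (a - 1 / 2) - 1 / 2))) * R ^ (n * (a + b - 1) * (1 / 2)) := by gcongr
      _ = _ := by ring
  linarith

/-- If a + b = 1 the power of δ disappears. The dyadic sum equals J on the shell of thickness δ² =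
4^(-J), while its inverse transform has norm O(J^a) with a < 1. -/
theorem one_lt_add_of_symmetricRestrictionEstimate [Nonempty {i // ¬ P i}]
    (hq : 1 ≤ q) (hpa : (1 / p).toReal = a) (hqb : (1 / q).toReal = b)
    (hm : 2 ≤ Fintype.card {i // P i})
    (ha : a = (Fintype.card {i // P i} + 1) / (2 * Fintype.card {i // P i}))
    (h : SymmetricRestrictionEstimate d k p q)
    (hP : ∀ A ∈ blockOrthogonalGroup d k, ∀ i j, ¬ (P i ↔ P j) →
      (A : Matrix (Fin d) (Fin d) ℝ) i j = 0) : 1 < a + b := by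
  have hm2 : (2 : ℝ) ≤ Fintype.card {i // P i} := by exact_mod_cast hm
  have ha0 : 0 < a := by rw [ha]; positivity
  have ha1 : a < 1 := by
    rw [ha, div_lt_one (by positivity)]; linarith
  refine lt_of_le_of_ne (one_le_add_of_symmetricRestrictionEstimate hq hpa hqb ha0 h hP)
    fun hab => ?_
  obtain ⟨C, hC0, hC⟩ := h.exists_le_tensor hq hpa hqb ha0 P hP
  obtain ⟨D, hD0, hD⟩ := exists_eLpNorm_fourierInv_logBump_le
      (E := EuclideanSpace ℝ {i // P i}) hpa (by rw [finrank_euclideanSpace]; exact ha)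
  refine not_forall_natCast_le_mul_rpow (C := C * D) ha1 fun J hJ => ?_
  have h0 := hC (logBump _ J) ((1 / 2) ^ J) J (hasCompactSupport_logBump J)
    (fun _ _ => logBump_eq_of_norm_eq J) (by positivity)
    (pow_le_one₀ (by norm_num) (by norm_num)) (Nat.cast_nonneg J) fun ζ hζ => by
      rw [logBump_eq_natCast hζ, Complex.norm_natCast]
  have h1 := h0.trans (mul_le_mul_right (hD J hJ) _)
  rw [← ENNReal.ofReal_mul hC0.le, ENNReal.ofReal_le_ofReal_iff (by positivity), ← hab, sub_self,
    mul_zero, Real.rpow_zero, mul_one] at h1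
  linarith

end

/-- The radial factor is to live on the smaller block, whichever of the two it is; block diagonality
is symmetric under exchanging the blocks. -/
theorem exists_predicate_of_blockOrthogonalGroup {d k m : ℕ} (hk : k ≤ d)
    (hm : m = min (d - k) k) :
    ∃ (P : Fin d → Prop) (_ : DecidablePred P), Fintype.card {i // P i} = m ∧
      Fintype.card {i // ¬ P i} = d - m ∧
      ∀ A ∈ blockOrthogonalGroup d k, ∀ i j, ¬ (P i ↔ P j) →
        (A : Matrix (Fin d) (Fin d) ℝ) i j = 0 := by
  have hcard : Fintype.card {i : Fin d // (i : ℕ) < d - k} = d - k := by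
    rw [Fintype.card_subtype, Fin.card_filter_val_lt]
    omega
  have hcompl : Fintype.card {i : Fin d // ¬ (i : ℕ) < d - k} = k := by
    rw [Fintype.card_subtype_compl, hcard, Fintype.card_fin]; omega
  rcases le_total (d - k) k with h | h
  · refine ⟨fun i => (i : ℕ) < d - k, inferInstance, ?_, ?_, fun A hA i j hij => hA i j hij⟩
    · rw [hcard]; omega
    · rw [hcompl]; omega
  · refine ⟨fun i => ¬ (i : ℕ) < d - k, inferInstance, ?_, ?_,
      fun A hA i j hij => hA i j fun h' => hij (not_congr h')⟩
    · rw [hcompl]; omega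
    · rw [Fintype.card_subtype_compl, hcompl, Fintype.card_fin]; omega

end NecessaryConditions

theorem theorem3 (d k m : ℕ) (hd : 4 ≤ d) (hk : 2 ≤ k) (hkd : k ≤ d - 2)
    (hm : m = min (d - k) k) (p q : ℝ≥0∞) (hp : 1 ≤ p) (hq : 1 ≤ q)
    (h : SymmetricRestrictionEstimate d k p q) :
    (((d : ℝ) + 1) / (2 * d) < (1 / p).toReal ∧ (1 / p).toReal < ((m : ℝ) + 1) / (2 * m) ∧
        (d : ℝ) + 1 ≤ ((d : ℝ) + m) * (1 / p).toReal + ((d : ℝ) - m) * (1 / q).toReal) ∨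
      ((1 / p).toReal = ((m : ℝ) + 1) / (2 * m) ∧ 1 < (1 / p).toReal + (1 / q).toReal) ∨
      (((m : ℝ) + 1) / (2 * m) < (1 / p).toReal ∧ 1 ≤ (1 / p).toReal + (1 / q).toReal) := by
  obtain ⟨a, hpa⟩ : ∃ a, (1 / p).toReal = a := ⟨_, rfl⟩
  obtain ⟨b, hqb⟩ : ∃ b, (1 / q).toReal = b := ⟨_, rfl⟩
  obtain ⟨P, _, hP1, hP2, hP⟩ := exists_predicate_of_blockOrthogonalGroup (d := d) (k := k)
    (by omega) hm
  have hm2 : 2 ≤ m := by omega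
  have hmd : m < d := by omega
  have : Nonempty {i // P i} := Fintype.card_pos_iff.1 (by omega)
  have : Nonempty {i // ¬ P i} := Fintype.card_pos_iff.1 (by omega)
  have hm0 : (2 : ℝ) ≤ m := by exact_mod_cast hm2
  have hdm : ((d - m : ℕ) : ℝ) = d - m := Nat.cast_sub hmd.le
  have ha := lt_of_symmetricRestrictionEstimate (by omega) hp hq hpa h
  have ha2 : 1 / 2 < a := by
    refine lt_trans ?_ ha
    have : (4 : ℝ) ≤ d := by exact_mod_cast hd
    rw [lt_div_iff₀ (by positivity)]
    linarith
  rw [hpa, hqb]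
  rcases lt_trichotomy a (((m : ℝ) + 1) / (2 * m)) with hlt | heq | hgt
  · refine Or.inl ⟨ha, hlt, ?_⟩
    -- In this range m(2a - 1) < 1, well within the condition m(2a - 1) < 2 of the weighted bound.
    rw [lt_div_iff₀ (by positivity)] at hlt
    have key := le_of_symmetricRestrictionEstimate_of_lt hq hpa hqb ha2
      (by rw [hP1]; nlinarith) h hP
    rw [hP1, hP2, hdm] at key
    -- Expanding (d - m)(a + b - 1) + m(2a - 1) ≥ 1 gives (d + m)a + (d - m)b ≥ d + 1.
    linarith
  · exact Or.inr (Or.inl ⟨heq, one_lt_add_of_symmetricRestrictionEstimate hq hpa hqb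
      (by rw [hP1]; exact hm2) (by rw [hP1]; exact heq) h hP⟩)
  · exact Or.inr (Or.inr ⟨hgt, one_le_add_of_symmetricRestrictionEstimate hq hpa hqb
      (by linarith) h hP⟩)
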